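/- Let $U\subseteq\mathbb{C}^N$ be open, let $\mathcal{O}(U)$ be the ring of holomorphic functions on $U$, let $\varphi=(\varphi_1,\dots,\varphi_p)\colon U\to\mathbb{C}^p$ be holomorphic, and let $Y=\varphi^{-1}(0)\subseteq U$. Assume that $Y$ has pure dimension $d$ and that $\varphi_1,\dots,\varphi_p$ generate the ideal of $Y$ at every point of $Y$ (every germ of holomorphic function at $y\in Y$ that vanishes on $Y$ is a combination of the germs of the $\varphi_j$ with holomorphic coefficients). Let $g\colon U\to\mathbb{C}$ be holomorphic. A point of $Y$ is regular if $Y$ is a complex submanifold of $\mathbb{C}^N$ near it, and singular otherwise; $S(Y)$ denotes the set of singular points of $Y$. A regular point $y$ of $Y$ is a degenerate critical point of $g|_Y$ if, in local coordinates of the manifold $Y$ near $y$, the differential of $g|_Y$ vanishes at $y$ and the determinant of its Hessian matrix at $y$ is zero. For an ideal $W=\langle w_1,\dots,w_r\rangle\subseteq\mathcal{O}(U)$ and an integer $m\ge 0$, let $\Delta_m(g,W)=W+W'$, where $W'$ is the ideal generated by the minors of order $m$ of the Jacobian matrix of $(g,w_1,\dots,w_r)$; this does not depend on the generators of $W$.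 Put $$J_{d}(g,W)=\Delta_{N-d+1}(g,W),\qquad J_{d,1}(g,W)=\Delta_{N}\bigl(g,J_{d}(g,W)\bigr),$$ and let $v(J)\subseteq U$ denote the common zero set of an ideal $J\subseteq\mathcal{O}(U)$. Then the set of points $y\in Y$ such that either $y$ is a singular point of $Y$ or $y$ is a degenerate critical point of $g|_Y$ is equal to $$v\bigl(J_{d,1}(g,\langle\varphi_1,\dots,\varphi_p\rangle)\bigr)\cup S(Y),$$ and this set is an analytic subset of $U$. -/

import Mathlib

open Filter Topology TopologicalSpace

noncomputable section

namespace JacobianExtension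

/-! ### Rings of holomorphic functions -/

/-- Extension by zero of a function on an open set `U ⊆ ℂ^N`. -/
def ext {N : ℕ} {U : Opens (Fin N → ℂ)} (f : U → ℂ) : (Fin N → ℂ) → ℂ :=
  Function.extend Subtype.val f 0

theorem ext_apply {N : ℕ} {U : Opens (Fin N → ℂ)} (f : U → ℂ) (x : U) : ext f x = f x :=
  Subtype.val_injective.extend_apply f 0 x

theorem analyticOnNhd_ext_iff {N : ℕ} {U : Opens (Fin N → ℂ)} {f : U → ℂ}
    {F : (Fin N → ℂ) → ℂ} (h : ∀ x : U, F x = f x) :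
    AnalyticOnNhd ℂ (ext f) U ↔ AnalyticOnNhd ℂ F U :=
  analyticOnNhd_congr U.isOpen fun x hx => (ext_apply f ⟨x, hx⟩).trans (h ⟨x, hx⟩).symm

/-- The ring `𝒪(U)` of holomorphic functions on an open set `U ⊆ ℂ^N`. -/
def Hol {N : ℕ} (U : Opens (Fin N → ℂ)) : Subalgebra ℂ (U → ℂ) where
  carrier := {f | AnalyticOnNhd ℂ (ext f) U}
  mul_mem' {f g} hf hg :=
    (analyticOnNhd_ext_iff (F := ext f * ext g) fun x => by simp [ext_apply]).2 (hf.mul hg)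
  add_mem' {f g} hf hg :=
    (analyticOnNhd_ext_iff (F := ext f + ext g) fun x => by simp [ext_apply]).2 (hf.add hg)
  algebraMap_mem' c :=
    (analyticOnNhd_ext_iff (F := fun _ => c) fun x => by simp).2 analyticOnNhd_const

/-- The partial derivative `∂f/∂x_j` at `x` of a function of `n` complex variables. -/
def partialDeriv {n : ℕ} (j : Fin n) (f : (Fin n → ℂ) → ℂ) (x : Fin n → ℂ) : ℂ :=
  fderiv ℂ f x (Pi.single j 1)

/-- The partial derivative `∂/∂x_j` as an operator on `𝒪(U)`. -/
def Hol.pd {N : ℕ} {U : Opens (Fin N → ℂ)} (j : Fin N) (f : Hol U) : Hol U :=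
  ⟨fun x => partialDeriv j (ext f.1) x,
    (analyticOnNhd_ext_iff (F := partialDeriv j (ext f.1)) fun _ => rfl).2 fun x hx =>
      ((ContinuousLinearMap.apply ℂ ℂ (Pi.single j 1 : Fin N → ℂ)).analyticAt _).comp
        (AnalyticOnNhd.fderiv f.2 x hx)⟩

/-- The zero set `v(J) ⊆ U` of an ideal `J` of `𝒪(U)`. -/
def zeroLocus {N : ℕ} {U : Opens (Fin N → ℂ)} (J : Ideal (Hol U)) : Set (Fin N → ℂ) :=
  {x | ∃ hx : x ∈ U, ∀ f ∈ J, f.1 ⟨x, hx⟩ = 0}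

/-- The fibre `φ⁻¹(0) ⊆ U` of a holomorphic map `φ : U → ℂ^p`. -/
def zeroFibre {N p : ℕ} {U : Opens (Fin N → ℂ)} (φ : Fin p → Hol U) : Set (Fin N → ℂ) :=
  {x | ∃ hx : x ∈ U, ∀ j, (φ j).1 ⟨x, hx⟩ = 0}

/-! ### Jacobian extensions -/

/-- The ideal `I_m(A)` generated by the minors of order `m` of `A`. (A choice of rows or columns
with repetitions contributes a zero determinant.) -/
def minorsIdeal {R ι κ : Type*} [CommRing R] (A : Matrix ι κ R) (m : ℕ) : Ideal R :=
  Ideal.span {a | ∃ (r : Fin m → ι) (c : Fin m → κ), a = (A.submatrix r c).det}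

/-- The Jacobian matrix of a family of holomorphic functions. -/
def jacobianMatrix {N : ℕ} {U : Opens (Fin N → ℂ)} {ι : Type*} (f : ι → Hol U) :
    Matrix ι (Fin N) (Hol U) :=
  Matrix.of fun i j => Hol.pd j (f i)

/-- The Jacobian extension of rank `m`, `Δ_m(h, W) = W + W'`, where `W'` is generated by the minors
of order `m` of the Jacobian matrix of `h` together with generators of `W`. All the elements of `W`
are taken as generators here; by `jacobianExtension_span` any other generators give the same
ideal. -/
def jacobianExtension {N : ℕ} {U : Opens (Fin N → ℂ)} {κ : Type*} (m : ℕ) (h : κ → Hol U)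
    (W : Ideal (Hol U)) : Ideal (Hol U) :=
  W ⊔ minorsIdeal (jacobianMatrix (Sum.elim h (fun w : W => (w : Hol U)))) m

/-- The iterated Jacobian extension `J_i(h, W)` along `i = (i_1, …, i_k)`:
`J_{i_1}(h, W) = Δ_{N - i_1 + 1}(h, W)` and
`J_{i_1, …, i_k}(h, W) = Δ_{N - i_k + 1}(h, J_{i_1, …, i_{k-1}}(h, W))`. -/
def iteratedJacobianExtension {N : ℕ} {U : Opens (Fin N → ℂ)} {κ : Type*} (i : List ℕ)
    (h : κ → Hol U) (W : Ideal (Hol U)) : Ideal (Hol U) :=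
  i.foldl (fun J a => jacobianExtension (N + 1 - a) h J) W

theorem Hol.pd_add {N : ℕ} {U : Opens (Fin N → ℂ)} (j : Fin N) (f g : Hol U) :
    Hol.pd j (f + g) = Hol.pd j f + Hol.pd j g := by
  apply Subtype.ext
  funext x
  have hf := (f.2 x x.2).differentiableAt
  have hg := (g.2 x x.2).differentiableAt
  have e : ext (f + g).1 =ᶠ[𝓝 (x : Fin N → ℂ)] ext f.1 + ext g.1 := by
    filter_upwards [U.isOpen.mem_nhds x.2] with y hy
    have h1 := ext_apply (f + g).1 ⟨y, hy⟩
    have h2 := ext_apply f.1 ⟨y, hy⟩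
    have h3 := ext_apply g.1 ⟨y, hy⟩
    change ext (f + g).1 y = ext f.1 y + ext g.1 y
    exact h1.trans (by rw [h2, h3]; rfl)
  change fderiv ℂ (ext (f + g).1) x _ = fderiv ℂ (ext f.1) x _ + fderiv ℂ (ext g.1) x _
  rw [e.fderiv_eq, fderiv_add hf hg]
  rfl

theorem Hol.pd_mul {N : ℕ} {U : Opens (Fin N → ℂ)} (j : Fin N) (f g : Hol U) :
    Hol.pd j (f * g) = f * Hol.pd j g + g * Hol.pd j f := by
  apply Subtype.ext
  funext x
  have hf := (f.2 x x.2).differentiableAt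
  have hg := (g.2 x x.2).differentiableAt
  have e : ext (f * g).1 =ᶠ[𝓝 (x : Fin N → ℂ)] ext f.1 * ext g.1 := by
    filter_upwards [U.isOpen.mem_nhds x.2] with y hy
    have h1 := ext_apply (f * g).1 ⟨y, hy⟩
    have h2 := ext_apply f.1 ⟨y, hy⟩
    have h3 := ext_apply g.1 ⟨y, hy⟩
    change ext (f * g).1 y = ext f.1 y * ext g.1 y
    exact h1.trans (by rw [h2, h3]; rfl)
  change fderiv ℂ (ext (f * g).1) x _
    = f.1 x * fderiv ℂ (ext g.1) x _ + g.1 x * fderiv ℂ (ext f.1) x _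
  rw [e.fderiv_eq, fderiv_mul hf hg]
  simp [ext_apply]

theorem det_eq_zero_of_rows_mem_span {R : Type*} [CommRing R] {m : ℕ} (S : Set (Fin m → R))
    (hS : ∀ v : Matrix (Fin m) (Fin m) R, (∀ i, v i ∈ S) → v.det = 0)
    (v : Matrix (Fin m) (Fin m) R) (hv : ∀ i, v i ∈ Submodule.span R S) : v.det = 0 := by
  suffices H : ∀ (s : Finset (Fin m)) (v : Matrix (Fin m) (Fin m) R),
      (∀ i ∈ s, v i ∈ Submodule.span R S) → (∀ i ∉ s, v i ∈ S) → v.det = 0 from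
    H Finset.univ v (fun i _ => hv i) (fun i hi => absurd (Finset.mem_univ i) hi)
  intro s
  induction s using Finset.induction_on with
  | empty => exact fun v _ h => hS v fun i => h i (by simp)
  | insert a s ha ih =>
    intro v h1 h2
    suffices H : ∀ x ∈ Submodule.span R S, (v.updateRow a x).det = 0 by
      have := H (v a) (h1 a (by simp))
      rwa [Matrix.updateRow_eq_self] at this
    intro x hx
    induction hx using Submodule.span_induction with
    | mem x hx =>
      apply ih
      · intro i hi
        rw [Matrix.updateRow_ne (by rintro rfl; exact ha hi)]
        exact h1 i (by simp [hi])
      · intro i hi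
        by_cases hia : i = a
        · subst hia; simpa using hx
        · rw [Matrix.updateRow_ne hia]
          exact h2 i (by simp [hi, hia])
    | zero => exact Matrix.det_eq_zero_of_row_eq_zero a (by simp)
    | add x y _ _ hx hy => rw [Matrix.det_updateRow_add, hx, hy, add_zero]
    | smul r x _ hx => rw [Matrix.det_updateRow_smul, hx, mul_zero]

theorem det_mem_of_derivations {R κ ι : Type*} [CommRing R] {n m : ℕ} (D : Fin n → R → R)
    (hadd : ∀ j a b, D j (a + b) = D j a + D j b)
    (hmul : ∀ j a b, D j (a * b) = a * D j b + b * D j a) (h : κ → R) (w : ι → R)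
    (K : Ideal R) (hwK : Ideal.span (Set.range w) ≤ K)
    (hK : ∀ (r : Fin m → κ ⊕ ι) (c : Fin m → Fin n),
      (Matrix.of fun i j => D (c j) (Sum.elim h w (r i))).det ∈ K)
    (r : Fin m → R) (hr : ∀ i, (∃ k, r i = h k) ∨ r i ∈ Ideal.span (Set.range w))
    (c : Fin m → Fin n) : (Matrix.of fun i j => D (c j) (r i)).det ∈ K := by
  let q := Ideal.Quotient.mk K
  let row : R → Fin m → (R ⧸ K) := fun f j => q (D (c j) f)
  have hW : ∀ f ∈ Ideal.span (Set.range w), q f = 0 := fun f hf =>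
    Ideal.Quotient.eq_zero_iff_mem.2 (hwK hf)
  let S : Set (Fin m → (R ⧸ K)) := Set.range fun k : κ ⊕ ι => row (Sum.elim h w k)
  have hrow : ∀ f ∈ Ideal.span (Set.range w), row f ∈ Submodule.span (R ⧸ K) S := by
    intro f hf
    induction hf using Submodule.span_induction with
    | mem f hf =>
      obtain ⟨i, rfl⟩ := hf
      exact Submodule.subset_span ⟨Sum.inr i, rfl⟩
    | zero =>
      have : row 0 = 0 := by
        funext j
        have := hadd (c j) 0 0
        simp only [add_zero, left_eq_add] at this
        simp [row, this]
      rw [this]; exact Submodule.zero_mem _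
    | add f g hf hg ihf ihg =>
      have : row (f + g) = row f + row g := by
        funext j; simp [row, hadd]
      rw [this]; exact Submodule.add_mem _ ihf ihg
    | smul a f hf ih =>
      have : row (a • f) = q a • row f := by
        funext j; simp [row, hmul, hW f hf]
      rw [this]; exact Submodule.smul_mem _ _ ih
  apply Ideal.Quotient.eq_zero_iff_mem.1
  change q _ = 0
  rw [RingHom.map_det]
  apply det_eq_zero_of_rows_mem_span S
  · intro v hv
    choose k hk using hv
    have : v = q.mapMatrix (Matrix.of fun i j => D (c j) (Sum.elim h w (k i))) := by
      ext i j
      rw [← hk i]; rfl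
    rw [this, ← RingHom.map_det]
    exact Ideal.Quotient.eq_zero_iff_mem.2 (hK k c)
  · intro i
    change row (r i) ∈ _
    rcases hr i with ⟨k, hk⟩ | hi
    · rw [hk]; exact Submodule.subset_span ⟨Sum.inl k, rfl⟩
    · exact hrow _ hi

/-- The Jacobian extension may be computed from any family of generators. -/
theorem jacobianExtension_span {N : ℕ} {U : Opens (Fin N → ℂ)} {κ ι : Type*} (m : ℕ)
    (h : κ → Hol U) (w : ι → Hol U) :
    jacobianExtension m h (Ideal.span (Set.range w)) =
      Ideal.span (Set.range w) ⊔ minorsIdeal (jacobianMatrix (Sum.elim h w)) m := by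
  apply le_antisymm
  · refine sup_le le_sup_left (Ideal.span_le.2 ?_)
    rintro _ ⟨r, c, rfl⟩
    refine det_mem_of_derivations (fun j => Hol.pd j) Hol.pd_add Hol.pd_mul h w
      (Ideal.span (Set.range w) ⊔ minorsIdeal (jacobianMatrix (Sum.elim h w)) m) le_sup_left
      (fun r c => Ideal.mem_sup_right (Ideal.subset_span ⟨r, c, rfl⟩))
      (fun i => Sum.elim h (fun f : Ideal.span (Set.range w) => (f : Hol U)) (r i)) ?_ c
    intro i
    rcases r i with k | f
    · exact Or.inl ⟨k, rfl⟩
    · exact Or.inr f.2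
  · refine sup_le le_sup_left (le_trans (Ideal.span_mono ?_) le_sup_right)
    rintro _ ⟨r, c, rfl⟩
    refine ⟨fun i => Sum.map id
      (fun k => (⟨w k, Ideal.subset_span ⟨k, rfl⟩⟩ : Ideal.span (Set.range w))) (r i), c, ?_⟩
    congr 1
    ext i j
    rcases hr : r i with k | k <;> simp [jacobianMatrix, hr]

/-! ### Regular points, dimension and degenerate critical points -/

/-- `e` is a biholomorphic map from a neighbourhood of `y` in `ℂ^N` onto an open subset of
`ℂ^k × ℂ^l` that carries `Y` to `ℂ^k × {0}`. -/
structure IsStraightening {N k l : ℕ} (Y : Set (Fin N → ℂ)) (y : Fin N → ℂ)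
    (e : OpenPartialHomeomorph (Fin N → ℂ) ((Fin k → ℂ) × (Fin l → ℂ))) : Prop where
  mem_source : y ∈ e.source
  analytic : AnalyticOnNhd ℂ e e.source
  analytic_symm : AnalyticOnNhd ℂ e.symm e.target
  mem_iff : ∀ x ∈ e.source, x ∈ Y ↔ (e x).2 = 0

/-- `y` is a regular point of `Y` at which `Y` has dimension `k`: near `y`, the set `Y` is a complex
submanifold of dimension `k`. -/
def IsRegularPoint {N : ℕ} (Y : Set (Fin N → ℂ)) (k : ℕ) (y : Fin N → ℂ) : Prop :=
  y ∈ Y ∧ ∃ (l : ℕ) (e : OpenPartialHomeomorph (Fin N → ℂ) ((Fin k → ℂ) × (Fin l → ℂ))),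
    IsStraightening Y y e

/-- The singular locus `S(Y)`: the points of `Y` that are not regular. -/
def singularLocus {N : ℕ} (Y : Set (Fin N → ℂ)) : Set (Fin N → ℂ) :=
  {y | y ∈ Y ∧ ∀ k, ¬ IsRegularPoint Y k y}

/-- The analytic set `Y` has pure dimension `d`: at every point `y` of `Y`, the largest dimension of
`Y` at regular points that accumulate at `y` (or equal `y`) is `d`. -/
def HasPureDim {N : ℕ} (Y : Set (Fin N → ℂ)) (d : ℕ) : Prop :=
  ∀ y ∈ Y, (∃ᶠ z in 𝓝 y, IsRegularPoint Y d z) ∧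
    ∀ᶠ z in 𝓝 y, ∀ k, IsRegularPoint Y k z → k ≤ d

/-- `φ` generates the ideal of `Y` at every point `y` of `Y`: each germ of a holomorphic function at
`y` that vanishes on `Y` is a combination of the components of `φ` with holomorphic coefficients. -/
def GeneratesIdealOf {N p : ℕ} {U : Opens (Fin N → ℂ)} (φ : Fin p → Hol U)
    (Y : Set (Fin N → ℂ)) : Prop :=
  ∀ y ∈ Y, ∀ f : (Fin N → ℂ) → ℂ, AnalyticAt ℂ f y → (∀ᶠ x in 𝓝 y, x ∈ Y → f x = 0) →
    ∃ a : Fin p → (Fin N → ℂ) → ℂ, (∀ j, AnalyticAt ℂ (a j) y) ∧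
      ∀ᶠ x in 𝓝 y, f x = ∑ j, a j x * ext (φ j).1 x

/-- The Hessian matrix of a function of `n` complex variables. -/
def hessian {n : ℕ} (f : (Fin n → ℂ) → ℂ) (u : Fin n → ℂ) : Matrix (Fin n) (Fin n) ℂ :=
  Matrix.of fun i j => partialDeriv i (partialDeriv j f) u

/-- `y` is a degenerate critical point of `g|_Y`: it is a regular point of `Y`, and in local
coordinates `u` of the manifold `Y` near `y` the differential of `g` vanishes at `y` and its Hessian
matrix there is singular. Only the values of `g` on `Y` enter. -/
def IsDegenerateCriticalPoint {N : ℕ} (Y : Set (Fin N → ℂ)) (g : (Fin N → ℂ) → ℂ)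
    (y : Fin N → ℂ) : Prop :=
  y ∈ Y ∧ ∃ (k l : ℕ) (e : OpenPartialHomeomorph (Fin N → ℂ) ((Fin k → ℂ) × (Fin l → ℂ))),
    IsStraightening Y y e ∧
    (∀ i, partialDeriv i (fun u => g (e.symm (u, 0))) (e y).1 = 0) ∧
    (hessian (fun u => g (e.symm (u, 0))) (e y).1).det = 0

/-- `A` is an analytic subset of `U`: near every point of `U` it is the common zero set of finitely
many holomorphic functions. -/
def IsAnalyticSubset {N : ℕ} (U : Opens (Fin N → ℂ)) (A : Set (Fin N → ℂ)) : Prop :=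
  A ⊆ U ∧ ∀ x ∈ U, ∃ V : Opens (Fin N → ℂ), x ∈ V ∧ V ≤ U ∧ ∃ (n : ℕ) (f : Fin n → Hol V),
    A ∩ V = zeroFibre f

end JacobianExtension

end

open JacobianExtension

noncomputable section

namespace JacobianExtension

/-! ### Minors and rank -/

open Matrix

/-! Let `y` be a regular point of `Y`. Because the `φ j` generate the ideal of `Y` at `y`, the
common kernel of their differentials is the tangent space `T` of `Y`, so their Jacobian matrix has
rank equal to the codimension `l = N - d` (`rank_jacobianAt`). Bordering it by `dg` therefore keeps
all minors of order `l + 1` zero exactly when `dg` vanishes on `T`: the first extension cuts out the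
critical points. The second extension vanishes at a critical point when some `v ≠ 0` is killed by
`dg`, by all `dφ j` and by the differentials of those minors; such a `v` lies in `T`. With Lagrange
multipliers `dg = ∑ a j • dφ j` at `y`, put `G₀ = g - ∑ a j * φ j`, which agrees with `g` on `Y` and
has zero differential at `y`. Along `Y` the minors of `(g, φ)` and `(G₀, φ)` coincide, since minors
of order `l + 1` of the Jacobian of `φ` vanish there. The border `dG₀` is zero at `y`, so the
derivative of a minor along `v` is the same minor with border `D²G₀(v, ·)` (`fderiv_minor`). All of
these vanish exactly when `D²G₀(v, ·)` is zero on `T`, that is, when `v` is a null vector of the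
Hessian of `g` on `Y` (`det_hessian_eq_zero_iff`). For analyticity, the Jacobian criterion
`mem_singularLocus_iff` describes `S(Y)` in `Y` by minors of order `N - d`. Its hard half compares
`Y` with the manifold cut out by `N - d` independent `φ j`, using pure dimension and the identity
theorem. -/

theorem exists_linearIndependent_row_submatrix {K ι κ : Type*} [Field K] [Finite ι] [Fintype κ]
    (A : Matrix ι κ K) {m : ℕ} (h : m ≤ A.rank) :
    ∃ r : Fin m → ι, LinearIndependent K (A.submatrix r id).row := by
  rw [A.rank_eq_finrank_span_row] at h
  obtain ⟨f, hf, -, hli⟩ := Submodule.exists_fun_fin_finrank_span_eq K (Set.range A.row)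
  choose s hs using hf
  refine ⟨fun i => s (Fin.castLE h i), ?_⟩
  have : (A.submatrix (fun i => s (Fin.castLE h i)) id).row = f ∘ Fin.castLE h :=
    funext fun i => hs _
  rw [this]
  exact hli.comp _ (Fin.castLE_injective h)

theorem exists_det_submatrix_ne_zero_iff {K ι κ : Type*} [Field K] [Finite ι] [Fintype κ]
    (A : Matrix ι κ K) (m : ℕ) :
    (∃ (r : Fin m → ι) (c : Fin m → κ), (A.submatrix r c).det ≠ 0) ↔ m ≤ A.rank := by
  constructor
  · rintro ⟨r, c, h⟩
    have h1 := rank_of_isUnit (A.submatrix r c) ((isUnit_iff_isUnit_det _).2 h.isUnit)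
    rw [Fintype.card_fin] at h1
    exact h1.symm.le.trans (rank_submatrix_le A r c)
  · intro h
    obtain ⟨r, hr⟩ := exists_linearIndependent_row_submatrix A h
    have hm : m ≤ (A.submatrix r id)ᵀ.rank := by
      rw [rank_transpose, hr.rank_matrix, Fintype.card_fin]
    obtain ⟨c, hc⟩ := exists_linearIndependent_row_submatrix _ hm
    refine ⟨r, c, ?_⟩
    rw [← det_transpose]
    exact ((isUnit_iff_isUnit_det _).1 (linearIndependent_rows_iff_isUnit.1 hc)).ne_zero

theorem rank_add_finrank_ker {K ι κ : Type*} [Field K] [Fintype κ] (A : Matrix ι κ K) :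
    A.rank + Module.finrank K A.mulVecLin.ker = Fintype.card κ := by
  rw [Matrix.rank, LinearMap.finrank_range_add_finrank_ker, Module.finrank_fintype_fun_eq_card]

theorem forall_det_submatrix_eq_zero_iff {K ι : Type*} [Field K] [Finite ι] {n : ℕ}
    (A : Matrix ι (Fin n) K) :
    (∀ (r : Fin n → ι) (c : Fin n → Fin n), (A.submatrix r c).det = 0) ↔
      ∃ v, v ≠ 0 ∧ A *ᵥ v = 0 := by
  have h1 := exists_det_submatrix_ne_zero_iff A n
  have h2 := rank_add_finrank_ker A
  rw [Fintype.card_fin] at h2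
  have h3 : A.mulVecLin.ker ≠ ⊥ ↔ ∃ v, v ≠ 0 ∧ A *ᵥ v = 0 := by
    rw [Submodule.ne_bot_iff]
    exact exists_congr fun v => and_comm
  rw [← h3, ← not_iff_not]
  push Not
  rw [h1, ← Submodule.finrank_eq_zero (R := K)]
  omega

/-- The matrix with first row `w` and further rows those of `A`. -/
def bordered {R ι κ : Type*} (w : κ → R) (A : Matrix ι κ R) : Matrix (Fin 1 ⊕ ι) κ R :=
  Matrix.of fun i j => Sum.elim (fun _ => w j) (fun k => A k j) i

/-- The extra row raises the rank exactly when it shrinks the kernel, and the rank of `A` is already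
`m`. -/
theorem forall_det_bordered_eq_zero_iff {K ι κ : Type*} [Field K] [Finite ι] [Fintype κ]
    (w : κ → K) (A : Matrix ι κ K) {m : ℕ} (hm : A.rank = m) :
    (∀ (r : Fin (m + 1) → Fin 1 ⊕ ι) (c : Fin (m + 1) → κ),
        ((bordered w A).submatrix r c).det = 0) ↔ ∀ v, A *ᵥ v = 0 → w ⬝ᵥ v = 0 := by
  have h1 := exists_det_submatrix_ne_zero_iff (bordered w A) (m + 1)
  have h2 := rank_add_finrank_ker A
  have h3 := rank_add_finrank_ker (bordered w A)
  have hB : ∀ v, bordered w A *ᵥ v = 0 ↔ w ⬝ᵥ v = 0 ∧ A *ᵥ v = 0 := by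
    intro v
    constructor
    · exact fun h => ⟨congrFun h (Sum.inl 0), funext fun i => congrFun h (Sum.inr i)⟩
    · rintro ⟨h, h'⟩
      funext i
      rcases i with i | i
      · exact h
      · exact congrFun h' i
  have hle : (bordered w A).mulVecLin.ker ≤ A.mulVecLin.ker := fun v hv => ((hB v).1 hv).2
  have h4 : (∀ v, A *ᵥ v = 0 → w ⬝ᵥ v = 0) ↔ A.mulVecLin.ker ≤ (bordered w A).mulVecLin.ker :=
    ⟨fun h v hv => (hB v).2 ⟨h v hv, hv⟩, fun h v hv => ((hB v).1 (h hv)).1⟩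
  rw [h4]
  have h5 : A.mulVecLin.ker ≤ (bordered w A).mulVecLin.ker ↔
      Module.finrank K A.mulVecLin.ker ≤ Module.finrank K (bordered w A).mulVecLin.ker :=
    ⟨Submodule.finrank_mono, fun h => (Submodule.eq_of_le_of_finrank_le hle h).ge⟩
  rw [h5, ← not_iff_not]
  push Not
  rw [h1]
  omega

theorem det_bordered_submatrix_eq_zero {R ι κ : Type*} [CommRing R] (w : κ → R) (A : Matrix ι κ R)
    {m : ℕ} (hA : ∀ (r : Fin m → ι) (c : Fin m → κ), (A.submatrix r c).det = 0)
    (r : Fin m → Fin 1 ⊕ ι) (c : Fin m → κ) (hr : ∀ i, r i ≠ Sum.inl 0) :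
    ((bordered w A).submatrix r c).det = 0 := by
  have : ∀ i, ∃ k, r i = Sum.inr k := by
    intro i
    rcases h : r i with k | k
    · exact absurd (h.trans (by rw [Subsingleton.elim k 0])) (hr i)
    · exact ⟨k, rfl⟩
  choose k hk using this
  rw [← hA k c]
  congr 1
  ext i j
  simp [bordered, hk]

/-- By linearity in the border row the two minors differ by a combination of minors in which a row
of `A` is the border; these are minors of `A` itself. -/
theorem det_bordered_add_sum {R ι κ : Type*} [CommRing R] [Fintype ι] (w : κ → R)
    (A : Matrix ι κ R) {m : ℕ}
    (hA : ∀ (r : Fin m → ι) (c : Fin m → κ), (A.submatrix r c).det = 0) (a : ι → R)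
    (r : Fin m → Fin 1 ⊕ ι) (c : Fin m → κ) :
    ((bordered (w + ∑ k, a k • A k) A).submatrix r c).det =
      ((bordered w A).submatrix r c).det := by
  by_cases hr : ∃ i, r i = Sum.inl 0
  swap
  · push Not at hr
    rw [det_bordered_submatrix_eq_zero _ A hA r c hr, det_bordered_submatrix_eq_zero _ A hA r c hr]
  obtain ⟨i, hi⟩ := hr
  -- If the border is selected twice, both determinants have equal rows.
  by_cases hr' : ∃ i', i' ≠ i ∧ r i' = Sum.inl 0
  · obtain ⟨i', hne, hi'⟩ := hr'
    rw [det_zero_of_row_eq hne, det_zero_of_row_eq hne] <;> ext j <;> simp [hi, hi']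
  push Not at hr'
  have hB : ∀ x : κ → R, (bordered x A).submatrix r c =
      ((bordered w A).submatrix r c).updateRow i fun j => x (c j) := by
    intro x
    ext i' j
    by_cases h : i' = i
    · subst h; simp [bordered, hi]
    · rw [updateRow_ne h]
      rcases h' : r i' with k | k
      · exact absurd (h'.trans (by rw [Subsingleton.elim k 0])) (hr' i' h)
      · simp [bordered, h']
  have hz : ∀ k, ((bordered (A k) A).submatrix r c).det = 0 := by
    intro k
    have : (bordered (A k) A).submatrix r c =
        A.submatrix (fun i => Sum.elim (fun _ => k) id (r i)) c := by
      ext i j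
      rcases h : r i with l | l <;> simp [bordered, h]
    rw [this, hA]
  have h1 : ((bordered w A).submatrix r c).updateRow i (fun j => (w + ∑ k, a k • A k) (c j)) =
      ((bordered w A).submatrix r c).updateRow i
        ((fun j => w (c j)) + ∑ k, a k • fun j => A k (c j)) := by
    congr 1; ext j; simp
  rw [hB (w + ∑ k, a k • A k), h1, det_updateRow_add, ← hB]
  have h2 : ∀ s : Finset ι, (((bordered w A).submatrix r c).updateRow i
        (∑ k ∈ s, a k • fun j => A k (c j))).det = 0 := by
    classical
    intro s
    induction s using Finset.induction_on with
    | empty => exact det_eq_zero_of_row_eq_zero i (by simp)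
    | insert k s hk ih =>
      rw [Finset.sum_insert hk, det_updateRow_add, ih, det_updateRow_smul, ← hB, hz, mul_zero,
        add_zero]
  rw [h2, add_zero]

/-! ### Derivatives of bordered minors -/

theorem analyticAt_det {E : Type*} [NormedAddCommGroup E] [NormedSpace ℂ E] {m : ℕ}
    {A : E → Matrix (Fin m) (Fin m) ℂ} {x : E} (hA : ∀ i j, AnalyticAt ℂ (fun z => A z i j) x) :
    AnalyticAt ℂ (fun z => (A z).det) x := by
  simp only [det_apply, Units.smul_def, zsmul_eq_mul]
  exact Finset.analyticAt_fun_sum _ fun σ _ => analyticAt_const.mul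
    (Finset.analyticAt_fun_prod _ fun k _ => hA _ _)

/-- Expand along row `i`: the cofactors do not involve that row, and their derivatives are
multiplied by entries that vanish at `x`. -/
theorem fderiv_det_of_row_eq_zero {E : Type*} [NormedAddCommGroup E] [NormedSpace ℂ E] {m : ℕ}
    {A : E → Matrix (Fin m) (Fin m) ℂ} {x : E} (hA : ∀ i j, AnalyticAt ℂ (fun z => A z i j) x)
    (i : Fin m) (h0 : ∀ j, A x i j = 0) (v : E) :
    fderiv ℂ (fun z => (A z).det) x v =
      ((A x).updateRow i fun j => fderiv ℂ (fun z => A z i j) x v).det := by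
  have hadj : ∀ j, DifferentiableAt ℂ (fun z => (A z).adjugate j i) x := by
    intro j
    simp only [adjugate_apply]
    refine (analyticAt_det fun k l => ?_).differentiableAt
    by_cases hk : k = i
    · simp only [hk, updateRow_self]; exact analyticAt_const
    · simp only [updateRow_ne hk]; exact hA _ _
  have h1 : (fun z => (A z).det) = fun z => ∑ j, A z i j * (A z).adjugate j i :=
    funext fun z => det_eq_sum_mul_adjugate_row _ _
  rw [h1, fderiv_fun_sum fun j _ => (hA i j).differentiableAt.fun_mul (hadj j),
    det_eq_sum_mul_adjugate_row _ i]
  simp only [_root_.sum_apply]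
  refine Finset.sum_congr rfl fun j _ => ?_
  rw [fderiv_fun_mul (hA i j).differentiableAt (hadj j)]
  simp [h0, adjugate_apply, mul_comm]

theorem fderiv_det_bordered_of_eq_zero {E ι κ : Type*} [NormedAddCommGroup E] [NormedSpace ℂ E]
    {w : E → κ → ℂ} {A : E → Matrix ι κ ℂ} {x v : E} (hw : ∀ j, AnalyticAt ℂ (fun z => w z j) x)
    (hA : ∀ i j, AnalyticAt ℂ (fun z => A z i j) x) (hw0 : w x = 0) {m : ℕ}
    (hA0 : ∀ (r : Fin m → ι) (c : Fin m → κ), ((A x).submatrix r c).det = 0)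
    (hA1 : ∀ (r : Fin m → ι) (c : Fin m → κ),
      fderiv ℂ (fun z => ((A z).submatrix r c).det) x v = 0)
    (r : Fin m → Fin 1 ⊕ ι) (c : Fin m → κ) :
    fderiv ℂ (fun z => ((bordered (w z) (A z)).submatrix r c).det) x v =
      ((bordered (fun j => fderiv ℂ (fun z => w z j) x v) (A x)).submatrix r c).det := by
  by_cases hr : ∃ i, r i = Sum.inl 0
  swap
  · push Not at hr
    have : ∀ i, ∃ k, r i = Sum.inr k := by
      intro i
      rcases h : r i with k | k
      · exact absurd (h.trans (by rw [Subsingleton.elim k 0])) (hr i)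
      · exact ⟨k, rfl⟩
    choose k hk using this
    have h1 : ∀ z, (bordered (w z) (A z)).submatrix r c = (A z).submatrix k c := by
      intro z; ext i j; simp [bordered, hk]
    simp only [h1]
    rw [hA1, det_bordered_submatrix_eq_zero _ _ hA0 r c hr]
  obtain ⟨i, hi⟩ := hr
  by_cases hr' : ∃ i', i' ≠ i ∧ r i' = Sum.inl 0
  · obtain ⟨i', hne, hi'⟩ := hr'
    have h1 : ∀ (b : κ → ℂ) (B : Matrix ι κ ℂ), ((bordered b B).submatrix r c).det = 0 := by
      intro b B
      rw [det_zero_of_row_eq hne]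
      ext j; simp [hi, hi']
    simp [h1]
  push Not at hr'
  rw [fderiv_det_of_row_eq_zero _ i]
  · congr 1
    ext i' j
    by_cases h : i' = i
    · subst h; simp [bordered, hi]
    · rw [updateRow_ne h]
      rcases h' : r i' with k | k
      · exact absurd (h'.trans (by rw [Subsingleton.elim k 0])) (hr' i' h)
      · simp [bordered, h']
  · simp [bordered, hi, hw0]
  · intro i' j
    rcases h' : r i' with k | k
    · simpa [bordered, h'] using hw _
    · simpa [bordered, h'] using hA _ _

/-! ### Straightenings -/

/-- The Jacobian matrix of a family of functions at a point. -/
def jacobianAt {N : ℕ} {ι : Type*} (f : ι → (Fin N → ℂ) → ℂ) (z : Fin N → ℂ) :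
    Matrix ι (Fin N) ℂ :=
  Matrix.of fun i j => partialDeriv j (f i) z

theorem fderiv_eq_dotProduct {N : ℕ} (f : (Fin N → ℂ) → ℂ) (z v : Fin N → ℂ) :
    fderiv ℂ f z v = (fun j => partialDeriv j f z) ⬝ᵥ v := by
  conv_lhs => rw [pi_eq_sum_univ' v]
  simp [dotProduct, partialDeriv, mul_comm]

theorem jacobianAt_mulVec_eq_zero_iff {N : ℕ} {ι : Type*} (f : ι → (Fin N → ℂ) → ℂ)
    (z v : Fin N → ℂ) : (jacobianAt f z).mulVec v = 0 ↔ ∀ i, fderiv ℂ (f i) z v = 0 := by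
  simp only [fderiv_eq_dotProduct]
  exact funext_iff

theorem analyticAt_partialDeriv {N : ℕ} {f : (Fin N → ℂ) → ℂ} {z : Fin N → ℂ}
    (hf : AnalyticAt ℂ f z) (j : Fin N) : AnalyticAt ℂ (partialDeriv j f) z :=
  ((ContinuousLinearMap.apply ℂ ℂ (Pi.single j 1 : Fin N → ℂ)).analyticAt _).comp hf.fderiv

namespace IsStraightening

variable {N k l : ℕ} {Y : Set (Fin N → ℂ)} {y : Fin N → ℂ}
  {e : OpenPartialHomeomorph (Fin N → ℂ) ((Fin k → ℂ) × (Fin l → ℂ))}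

theorem of_mem_source (h : IsStraightening Y y e) {z : Fin N → ℂ} (hz : z ∈ e.source) :
    IsStraightening Y z e :=
  ⟨hz, h.analytic, h.analytic_symm, h.mem_iff⟩

theorem hasFDerivAt (h : IsStraightening Y y e) : HasFDerivAt e (fderiv ℂ e y) y :=
  (h.analytic y h.mem_source).differentiableAt.hasFDerivAt

theorem hasFDerivAt_symm (h : IsStraightening Y y e) :
    HasFDerivAt e.symm (fderiv ℂ e.symm (e y)) (e y) :=
  (h.analytic_symm _ (e.map_source h.mem_source)).differentiableAt.hasFDerivAt

theorem fderiv_symm_fderiv (h : IsStraightening Y y e) (v : Fin N → ℂ) :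
    fderiv ℂ e.symm (e y) (fderiv ℂ e y v) = v := by
  have h1 := h.hasFDerivAt_symm.comp y h.hasFDerivAt
  have h2 : e.symm ∘ e =ᶠ[𝓝 y] id := by
    filter_upwards [e.open_source.mem_nhds h.mem_source] with x hx using e.left_inv hx
  exact DFunLike.congr_fun (h1.unique ((hasFDerivAt_id y).congr_of_eventuallyEq h2)) v

theorem fderiv_fderiv_symm (h : IsStraightening Y y e) (w : (Fin k → ℂ) × (Fin l → ℂ)) :
    fderiv ℂ e y (fderiv ℂ e.symm (e y) w) = w := by
  have h0 : HasFDerivAt e (fderiv ℂ e y) (e.symm (e y)) := by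
    rw [e.left_inv h.mem_source]; exact h.hasFDerivAt
  have h1 := h0.comp (e y) h.hasFDerivAt_symm
  have h2 : e ∘ e.symm =ᶠ[𝓝 (e y)] id := by
    filter_upwards [e.open_target.mem_nhds (e.map_source h.mem_source)] with x hx
      using e.right_inv hx
  exact DFunLike.congr_fun (h1.unique ((hasFDerivAt_id _).congr_of_eventuallyEq h2)) w

/-- The derivative of a straightening. -/
def fderivEquiv (h : IsStraightening Y y e) : (Fin N → ℂ) ≃ₗ[ℂ] (Fin k → ℂ) × (Fin l → ℂ) where
  __ := (fderiv ℂ e y).toLinearMap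
  invFun := fderiv ℂ e.symm (e y)
  left_inv := h.fderiv_symm_fderiv
  right_inv := h.fderiv_fderiv_symm

theorem add_eq (h : IsStraightening Y y e) : k + l = N := by
  simpa using h.fderivEquiv.finrank_eq.symm

theorem apply_eq (h : IsStraightening Y y e) (hy : y ∈ Y) : e y = ((e y).1, 0) :=
  Prod.ext rfl ((h.mem_iff y h.mem_source).1 hy)

theorem symm_apply_base (h : IsStraightening Y y e) (hy : y ∈ Y) : e.symm ((e y).1, 0) = y := by
  rw [← h.apply_eq hy, e.left_inv h.mem_source]

theorem symm_mem (h : IsStraightening Y y e) {u : Fin k → ℂ} (hu : (u, 0) ∈ e.target) :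
    e.symm (u, 0) ∈ Y :=
  (h.mem_iff _ (e.map_target hu)).2 (by rw [e.right_inv hu])

theorem eventually_mem_target (h : IsStraightening Y y e) (hy : y ∈ Y) :
    ∀ᶠ u in 𝓝 (e y).1, (u, (0 : Fin l → ℂ)) ∈ e.target := by
  have h1 : Continuous fun u : Fin k → ℂ => (u, (0 : Fin l → ℂ)) := by fun_prop
  refine h1.continuousAt.eventually_mem (e.open_target.mem_nhds ?_)
  rw [← h.apply_eq hy]
  exact e.map_source h.mem_source

/-- The parametrization of `Y` near `y`. -/
theorem analyticAt_param (h : IsStraightening Y y e) {u : Fin k → ℂ} (hu : (u, 0) ∈ e.target) :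
    AnalyticAt ℂ (fun u : Fin k → ℂ => e.symm (u, 0)) u :=
  AnalyticAt.comp (g := e.symm) (f := fun u => (u, 0)) (h.analytic_symm _ hu)
    (analyticAt_id.prod analyticAt_const)

theorem hasFDerivAt_param (h : IsStraightening Y y e) (hy : y ∈ Y) :
    HasFDerivAt (fun u : Fin k → ℂ => e.symm (u, 0))
      ((fderiv ℂ e.symm (e y)).comp (ContinuousLinearMap.inl ℂ (Fin k → ℂ) (Fin l → ℂ)))
      (e y).1 := by
  have h1 : HasFDerivAt e.symm (fderiv ℂ e.symm (e y))
      ((e y).1, (0 : Fin l → ℂ)) := by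
    have := h.hasFDerivAt_symm
    rwa [h.apply_eq hy] at this ⊢
  exact HasFDerivAt.comp (g := e.symm) (f := fun u => (u, 0)) (e y).1 h1
    (hasFDerivAt_prodMk_left (e y).1 (0 : Fin l → ℂ))

theorem tendsto_param (h : IsStraightening Y y e) (hy : y ∈ Y) :
    Tendsto (fun u : Fin k → ℂ => e.symm (u, 0)) (𝓝 (e y).1) (𝓝 y) := by
  have := (h.hasFDerivAt_param hy).continuousAt.tendsto
  rwa [h.symm_apply_base hy] at this

/-- Vectors of the form `fderiv ℂ e.symm (e y) (u, 0)` are the tangent vectors of `Y` at `y`;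
differentiate `f` along the parametrization. -/
theorem fderiv_eq_zero_of_eventually (h : IsStraightening Y y e) (hy : y ∈ Y)
    {f : (Fin N → ℂ) → ℂ} (hf : DifferentiableAt ℂ f y) (h0 : ∀ᶠ x in 𝓝 y, x ∈ Y → f x = 0)
    (u : Fin k → ℂ) : fderiv ℂ f y (fderiv ℂ e.symm (e y) (u, 0)) = 0 := by
  have h1 : HasFDerivAt f (fderiv ℂ f y) (e.symm ((e y).1, 0)) := by
    rw [h.symm_apply_base hy]; exact hf.hasFDerivAt
  have h2 := HasFDerivAt.comp (f := fun u : Fin k → ℂ => e.symm (u, 0)) (e y).1 h1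
    (h.hasFDerivAt_param hy)
  have h3 : (f ∘ fun u : Fin k → ℂ => e.symm (u, 0)) =ᶠ[𝓝 (e y).1] fun _ => 0 := by
    filter_upwards [(h.tendsto_param hy).eventually h0, h.eventually_mem_target hy] with u hu hu'
      using hu (h.symm_mem hu')
  exact DFunLike.congr_fun (h2.unique ((hasFDerivAt_const 0 _).congr_of_eventuallyEq h3)) u

variable {p : ℕ} {U : Opens (Fin N → ℂ)} {φ : Fin p → Hol U}

/-- The kernel of `dφ` is the tangent space. The nontrivial inclusion uses `hred`: the normal
coordinates of the chart vanish on `Y`, so they are combinations of the `φ j`, and at `y`, where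
every `φ j` is zero, their differentials are combinations of the `dφ j`. -/
theorem forall_fderiv_eq_zero_iff (h : IsStraightening (zeroFibre φ) y e) (hy : y ∈ zeroFibre φ)
    (hred : GeneratesIdealOf φ (zeroFibre φ)) (v : Fin N → ℂ) :
    (∀ j, fderiv ℂ (ext (φ j).1) y v = 0) ↔ ∃ u, fderiv ℂ e.symm (e y) (u, 0) = v := by
  obtain ⟨hyU, hy0⟩ := id hy
  have hφ : ∀ j, AnalyticAt ℂ (ext (φ j).1) y := fun j => (φ j).2 y hyU
  constructor
  · intro hv
    suffices h2 : (fderiv ℂ e y v).2 = 0 by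
      refine ⟨(fderiv ℂ e y v).1, ?_⟩
      conv_rhs => rw [← h.fderiv_symm_fderiv v]
      exact congrArg _ (Prod.ext rfl h2.symm)
    funext i
    have hi : HasFDerivAt (fun x => (e x).2 i) (((ContinuousLinearMap.proj i).comp
        (ContinuousLinearMap.snd ℂ (Fin k → ℂ) (Fin l → ℂ))).comp (fderiv ℂ e y)) y :=
      (((ContinuousLinearMap.proj i).comp (ContinuousLinearMap.snd ℂ (Fin k → ℂ)
        (Fin l → ℂ))).hasFDerivAt (x := e y)).comp y h.hasFDerivAt
    have hia : AnalyticAt ℂ (fun x => (e x).2 i) y :=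
      (((ContinuousLinearMap.proj i).comp (ContinuousLinearMap.snd ℂ (Fin k → ℂ)
        (Fin l → ℂ))).analyticAt _).comp (h.analytic y h.mem_source)
    obtain ⟨a, ha, hae⟩ := hred y hy _ hia (by
      filter_upwards [e.open_source.mem_nhds h.mem_source] with x hx hxY
      rw [(h.mem_iff x hx).1 hxY]; rfl)
    have h3 : HasFDerivAt (fun x => ∑ j, a j x * ext (φ j).1 x)
        (∑ j, (a j y • fderiv ℂ (ext (φ j).1) y + ext (φ j).1 y • fderiv ℂ (a j) y)) y :=
      HasFDerivAt.fun_sum fun j _ =>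
        (ha j).differentiableAt.hasFDerivAt.mul (hφ j).differentiableAt.hasFDerivAt
    have h4 := DFunLike.congr_fun (hi.unique (h3.congr_of_eventuallyEq hae)) v
    refine h4.trans ?_
    have h5 : ∀ j, ext (φ j).1 y = 0 := fun j => (ext_apply _ ⟨y, hyU⟩).trans (hy0 j)
    simp [hv, h5]
  · rintro ⟨u, rfl⟩ j
    refine h.fderiv_eq_zero_of_eventually hy (hφ j).differentiableAt (.of_forall ?_) u
    rintro x ⟨hx, hx'⟩
    exact (ext_apply _ ⟨x, hx⟩).trans (hx' j)

theorem rank_jacobianAt (h : IsStraightening (zeroFibre φ) y e) (hy : y ∈ zeroFibre φ)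
    (hred : GeneratesIdealOf φ (zeroFibre φ)) :
    (jacobianAt (fun j => ext (φ j).1) y).rank = l := by
  let T : (Fin k → ℂ) →ₗ[ℂ] (Fin N → ℂ) :=
    h.fderivEquiv.symm.toLinearMap ∘ₗ LinearMap.inl ℂ (Fin k → ℂ) (Fin l → ℂ)
  have hT : Function.Injective T := h.fderivEquiv.symm.injective.comp LinearMap.inl_injective
  have h1 : (jacobianAt (fun j => ext (φ j).1) y).mulVecLin.ker = T.range := by
    ext v
    exact (jacobianAt_mulVec_eq_zero_iff _ _ _).trans (h.forall_fderiv_eq_zero_iff hy hred v)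
  have h2 := rank_add_finrank_ker (jacobianAt (fun j => ext (φ j).1) y)
  rw [h1, LinearMap.finrank_range_of_inj hT] at h2
  have := h.add_eq
  simp at h2
  omega

end IsStraightening

/-- The regular points of a set of pure dimension `d` have dimension `d`. -/
theorem IsStraightening.eq_of_hasPureDim {N p k l d : ℕ} {U : Opens (Fin N → ℂ)}
    {φ : Fin p → Hol U} {y : Fin N → ℂ}
    {e : OpenPartialHomeomorph (Fin N → ℂ) ((Fin k → ℂ) × (Fin l → ℂ))}
    (h : IsStraightening (zeroFibre φ) y e) (hy : y ∈ zeroFibre φ)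
    (hred : GeneratesIdealOf φ (zeroFibre φ)) (hdim : HasPureDim (zeroFibre φ) d) : k = d := by
  -- At a `d`-dimensional regular point inside the domain of `e`, both charts compute the rank of
  -- the same Jacobian matrix, so `l = l'`.
  obtain ⟨z, ⟨hzY, l', e', h'⟩, hz⟩ :=
    ((hdim y hy).1.and_eventually (e.open_source.mem_nhds h.mem_source)).exists
  have h1 := (h.of_mem_source hz).rank_jacobianAt hzY hred
  have h2 := h'.rank_jacobianAt hzY hred
  have h3 := h.add_eq
  have h4 := h'.add_eq
  omega

/-! ### The Jacobian criterion -/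

/-- The analytic inverse function theorem, with a chart whose image is a ball. -/
theorem exists_openPartialHomeomorph_of_analyticAt {E F : Type*} [NormedAddCommGroup E]
    [NormedSpace ℂ E] [CompleteSpace E] [NormedAddCommGroup F] [NormedSpace ℂ F] [CompleteSpace F]
    {f : E → F} {y : E} (hf : AnalyticAt ℂ f y) (L : E ≃L[ℂ] F) (hL : fderiv ℂ f y = L)
    {V : Set E} (hV : V ∈ 𝓝 y) :
    ∃ (e : OpenPartialHomeomorph E F) (ε : ℝ), (∀ x, e x = f x) ∧ 0 < ε ∧ y ∈ e.source ∧
      e.source ⊆ V ∧ e.target = Metric.ball (f y) ε ∧ AnalyticOnNhd ℂ e e.source ∧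
      AnalyticOnNhd ℂ e.symm e.target := by
  have hs : HasStrictFDerivAt f (L : E →L[ℂ] F) y := hL ▸ hf.hasStrictFDerivAt
  set e₀ := hs.toOpenPartialHomeomorph f with he₀
  have hcoe : ⇑e₀ = f := hs.toOpenPartialHomeomorph_coe
  have hy : y ∈ e₀.source := hs.mem_toOpenPartialHomeomorph_source
  have hys : AnalyticAt ℂ e₀.symm (e₀ y) :=
    e₀.analyticAt_symm' hy (by rwa [hcoe]) (by rw [hcoe]; exact hL)
  have hev : ∀ᶠ w in 𝓝 (e₀ y), w ∈ e₀.target ∧ AnalyticAt ℂ e₀.symm w ∧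
      (e₀.symm w ∈ V ∧ AnalyticAt ℂ f (e₀.symm w)) := by
    refine Filter.Eventually.and (e₀.open_target.mem_nhds (e₀.map_source hy))
      (hys.eventually_analyticAt.and (hys.continuousAt.eventually
        (p := fun x => x ∈ V ∧ AnalyticAt ℂ f x) ?_))
    rw [e₀.left_inv hy]
    exact Filter.Eventually.and hV hf.eventually_analyticAt
  obtain ⟨ε, hε, hball⟩ := Metric.eventually_nhds_iff_ball.1 hev
  rw [hcoe] at hball
  -- Restricting the inverse rather than the map makes the target exactly a ball.
  let e := (e₀.symm.restrOpen (Metric.ball (f y) ε) Metric.isOpen_ball).symm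
  have hsrc : ∀ x ∈ e.source, x ∈ e₀.source ∧ f x ∈ Metric.ball (f y) ε := by
    intro x hx
    simpa [e, hcoe] using hx
  have htgt : e.target = Metric.ball (f y) ε := by
    ext w
    simp only [e, OpenPartialHomeomorph.symm_target, OpenPartialHomeomorph.restrOpen_source,
      OpenPartialHomeomorph.symm_source, Set.mem_inter_iff, and_iff_right_iff_imp]
    exact fun hw => (hball w hw).1
  have hinv : ∀ x ∈ e.source, e₀.symm (f x) = x := fun x hx => by
    rw [← hcoe]; exact e₀.left_inv (hsrc x hx).1
  refine ⟨e, ε, fun x => congrFun hcoe x, hε, ?_, ?_, htgt, ?_, ?_⟩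
  · simpa [e, hcoe, hε] using hy
  · intro x hx
    rw [← hinv x hx]
    exact (hball _ (hsrc x hx).2).2.2.1
  · intro x hx
    have h1 := (hball _ (hsrc x hx).2).2.2.2
    rw [hinv x hx] at h1
    change AnalyticAt ℂ e₀ x
    rwa [hcoe]
  · intro w hw
    rw [htgt] at hw
    exact (hball w hw).2.1

/-- `P` extends coordinates on the kernel; it supplies the linear functions that complete
independent `φ j` to a chart. -/
theorem exists_linearMap_injOn_ker {K V W : Type*} [Field K] [AddCommGroup V] [Module K V]
    [FiniteDimensional K V] [AddCommGroup W] [Module K W] (T : V →ₗ[K] W) {d : ℕ}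
    (hd : Module.finrank K T.ker = d) :
    ∃ P : V →ₗ[K] (Fin d → K), ∀ v, T v = 0 → P v = 0 → v = 0 := by
  let q : T.ker ≃ₗ[K] (Fin d → K) := LinearEquiv.ofFinrankEq _ _ (by simp [hd])
  obtain ⟨P, hP⟩ := LinearMap.exists_extend q.toLinearMap
  refine ⟨P, fun v hv hv' => ?_⟩
  have h1 : q ⟨v, hv⟩ = 0 := (DFunLike.congr_fun hP ⟨v, hv⟩).symm.trans hv'
  exact congrArg Subtype.val (q.map_eq_zero_iff.1 h1)

/-- A chart in which some of the defining functions are coordinates straightens a set that has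
the expected dimension at points close by. -/
theorem isStraightening_of_chart {N p d l : ℕ} {U : Opens (Fin N → ℂ)} {φ : Fin p → Hol U}
    {y : Fin N → ℂ} (hy : y ∈ zeroFibre φ) (hdim : HasPureDim (zeroFibre φ) d)
    (r : Fin l → Fin p) {e : OpenPartialHomeomorph (Fin N → ℂ) ((Fin d → ℂ) × (Fin l → ℂ))}
    (he : ∀ x i, (e x).2 i = ext (φ (r i)).1 x) {ε : ℝ} (hye : y ∈ e.source)
    (heU : e.source ⊆ U) (het : e.target = Metric.ball (e y) ε)
    (hea : AnalyticOnNhd ℂ e e.source) (hes : AnalyticOnNhd ℂ e.symm e.target) :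
    IsStraightening (zeroFibre φ) y e := by
  have he0 : ∀ x ∈ zeroFibre φ, (e x).2 = 0 := by
    rintro x ⟨hx, hx'⟩
    funext i
    rw [he]
    exact (ext_apply _ ⟨x, hx⟩).trans (hx' _)
  -- In the sup norm of the product, the slice of the target is a ball, hence connected.
  have hmem : ∀ u : Fin d → ℂ, (u, 0) ∈ e.target ↔ u ∈ Metric.ball (e y).1 ε := by
    intro u
    rw [het, Metric.mem_ball, Metric.mem_ball, Prod.dist_eq, he0 y hy, dist_self,
      max_eq_left dist_nonneg]
  obtain ⟨z, ⟨hzY, l', e', h'⟩, hze⟩ :=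
    ((hdim y hy).1.and_eventually (e.open_source.mem_nhds hye)).exists
  have hz : IsStraightening {x | (e x).2 = 0} z e := ⟨hze, hea, hes, fun _ _ => Iff.rfl⟩
  let s : (Fin d → ℂ) → (Fin N → ℂ) := fun u => e'.symm (u, 0)
  -- `τ` reads a parametrization of `Y` near `z` in the coordinates of the slice `(e x).2 = 0`,
  -- which contains `Y` within the chart. Both have dimension `d`, so once `dτ` is injective, `τ` is
  -- open and `Y` fills a neighbourhood of `z` in the slice.
  let τ : (Fin d → ℂ) → (Fin d → ℂ) := fun u => (e (s u)).1
  have hs0 : s (e' z).1 = z := h'.symm_apply_base hzY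
  have hτd : HasFDerivAt τ ((ContinuousLinearMap.fst ℂ (Fin d → ℂ) (Fin l → ℂ)).comp
      ((fderiv ℂ e z).comp ((fderiv ℂ e'.symm (e' z)).comp
        (ContinuousLinearMap.inl ℂ (Fin d → ℂ) (Fin l' → ℂ))))) (e' z).1 := by
    have h1 : HasFDerivAt e (fderiv ℂ e z) (s (e' z).1) := hs0.symm ▸ hz.hasFDerivAt
    exact (ContinuousLinearMap.fst ℂ (Fin d → ℂ) (Fin l → ℂ)).hasFDerivAt.comp _
      (h1.comp _ (h'.hasFDerivAt_param hzY))
  have hsa : AnalyticAt ℂ s (e' z).1 := h'.analyticAt_param (by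
    rw [← h'.apply_eq hzY]; exact e'.map_source h'.mem_source)
  have hτa : AnalyticAt ℂ τ (e' z).1 := by
    refine ((ContinuousLinearMap.fst ℂ (Fin d → ℂ) (Fin l → ℂ)).analyticAt _).comp
      (AnalyticAt.comp (g := e) (f := s) ?_ hsa)
    rw [hs0]
    exact hea z hze
  have hinj : Function.Injective (fderiv ℂ τ (e' z).1) := by
    rw [injective_iff_map_eq_zero]
    intro u hu
    rw [hτd.fderiv] at hu
    have h2 : (fderiv ℂ e z (fderiv ℂ e'.symm (e' z) (u, 0))).2 = 0 := by
      funext i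
      let q := (ContinuousLinearMap.proj (R := ℂ) (φ := fun _ : Fin l => ℂ) i).comp
        (ContinuousLinearMap.snd ℂ (Fin d → ℂ) (Fin l → ℂ))
      have h3 : HasFDerivAt (fun x => (e x).2 i) (q.comp (fderiv ℂ e z)) z :=
        (q.hasFDerivAt (x := e z)).comp z hz.hasFDerivAt
      have h4 := h'.fderiv_eq_zero_of_eventually hzY h3.differentiableAt
        (.of_forall fun x hx => by rw [he0 x hx]; rfl) u
      rwa [h3.fderiv] at h4
    have h3 : fderiv ℂ e z (fderiv ℂ e'.symm (e' z) (u, 0)) = 0 := Prod.ext hu h2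
    have h4 := (map_eq_zero_iff _ hz.fderivEquiv.injective).1 h3
    have h5 := (map_eq_zero_iff _ h'.fderivEquiv.symm.injective).1 h4
    exact congrArg Prod.fst h5
  have hopen : map τ (𝓝 (e' z).1) = 𝓝 (τ (e' z).1) :=
    hτa.hasStrictFDerivAt.map_nhds_eq_of_surj
      (LinearMap.range_eq_top.2 (LinearMap.injective_iff_surjective.1 hinj))
  have hev : ∀ᶠ u in 𝓝 (τ (e' z).1), e.symm (u, 0) ∈ zeroFibre φ := by
    rw [← hopen, eventually_map]
    filter_upwards [h'.eventually_mem_target hzY, (h'.tendsto_param hzY).eventually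
      (e.open_source.mem_nhds hze)] with u hu hu'
    have h1 : s u ∈ zeroFibre φ := h'.symm_mem hu
    have h2 : (τ u, 0) = e (s u) := Prod.ext rfl (he0 _ h1).symm
    rw [h2, e.left_inv hu']
    exact h1
  have hτz : τ (e' z).1 ∈ Metric.ball (e y).1 ε := by
    rw [← hmem]
    have h2 : (τ (e' z).1, 0) = e z := by
      refine Prod.ext ?_ (he0 _ hzY).symm
      change (e (s (e' z).1)).1 = _
      rw [hs0]
    rw [h2]
    exact e.map_source hze
  -- The identity theorem carries the vanishing of every `φ j` from near `z` to the whole slice.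
  have hvan : ∀ j, Set.EqOn (fun u => ext (φ j).1 (e.symm (u, 0))) 0 (Metric.ball (e y).1 ε) := by
    intro j
    refine AnalyticOnNhd.eqOn_zero_of_preconnected_of_eventuallyEq_zero (𝕜 := ℂ) (fun u hu => ?_)
      (convex_ball _ _).isPreconnected hτz ?_
    · have hu' := (hmem u).2 hu
      exact AnalyticAt.comp (g := ext (φ j).1) (f := fun u => e.symm (u, 0))
        ((φ j).2 _ (heU (e.map_target hu'))) (hz.analyticAt_param hu')
    · filter_upwards [hev] with u hu
      exact (ext_apply _ ⟨_, hu.1⟩).trans (hu.2 j)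
  refine ⟨hye, hea, hes, fun x hx => ⟨he0 x, fun hx0 => ⟨heU hx, fun j => ?_⟩⟩⟩
  have h1 : ((e x).1, 0) = e x := Prod.ext rfl hx0.symm
  have h2 := hvan j ((hmem _).1 (h1 ▸ e.map_source hx))
  simp only [h1, e.left_inv hx] at h2
  exact (ext_apply _ ⟨x, heU hx⟩).symm.trans h2

theorem isRegularPoint_of_det_ne_zero {N p d : ℕ} {U : Opens (Fin N → ℂ)} {φ : Fin p → Hol U}
    {y : Fin N → ℂ} (hy : y ∈ zeroFibre φ) (hdim : HasPureDim (zeroFibre φ) d)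
    {r : Fin (N - d) → Fin p} {c : Fin (N - d) → Fin N}
    (h : ((jacobianAt (fun j => ext (φ j).1) y).submatrix r c).det ≠ 0) :
    IsRegularPoint (zeroFibre φ) d y := by
  -- This keeps the subtraction in `N - d` from truncating.
  have hd : d ≤ N := by
    obtain ⟨z, -, l', e', h'⟩ := (hdim y hy).1.exists
    have := h'.add_eq
    omega
  have hya : ∀ j, AnalyticAt ℂ (ext (φ j).1) y := fun j => (φ j).2 y hy.1
  let B := (jacobianAt (fun j => ext (φ j).1) y).submatrix r id
  have hB : N - d ≤ B.rank := (exists_det_submatrix_ne_zero_iff B (N - d)).1 ⟨id, c, h⟩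
  have hB' : B.rank ≤ N - d := B.rank_le_height
  have hk := rank_add_finrank_ker B
  rw [Fintype.card_fin] at hk
  obtain ⟨P, hP⟩ := exists_linearMap_injOn_ker B.mulVecLin (d := d) (by omega)
  let L₀ : (Fin N → ℂ) →ₗ[ℂ] (Fin d → ℂ) × (Fin (N - d) → ℂ) := P.prod B.mulVecLin
  have hinj : Function.Injective L₀ := by
    rw [injective_iff_map_eq_zero]
    exact fun v hv => hP v (congrArg Prod.snd hv) (congrArg Prod.fst hv)
  let L : (Fin N → ℂ) ≃L[ℂ] (Fin d → ℂ) × (Fin (N - d) → ℂ) :=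
    (L₀.linearEquivOfInjective hinj (by simp; omega)).toContinuousLinearEquiv
  let f : (Fin N → ℂ) → (Fin d → ℂ) × (Fin (N - d) → ℂ) := fun x =>
    (P.toContinuousLinearMap x, fun i => ext (φ (r i)).1 x)
  have hfa : AnalyticAt ℂ f y :=
    (P.toContinuousLinearMap.analyticAt y).prod (AnalyticAt.pi fun i => hya (r i))
  have hfL : fderiv ℂ f y = L := by
    have h1 : HasFDerivAt f (P.toContinuousLinearMap.prod
        (ContinuousLinearMap.pi fun i => fderiv ℂ (ext (φ (r i)).1) y)) y :=
      P.toContinuousLinearMap.hasFDerivAt.prodMk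
        (hasFDerivAt_pi.2 fun i => (hya (r i)).differentiableAt.hasFDerivAt)
    rw [h1.fderiv]
    ext1 v
    refine Prod.ext rfl (funext fun i => ?_)
    exact fderiv_eq_dotProduct _ _ _
  obtain ⟨e, ε, hef, -, hye, heU, het, hea, hes⟩ :=
    exists_openPartialHomeomorph_of_analyticAt hfa L hfL (U.isOpen.mem_nhds hy.1)
  exact ⟨hy, N - d, e, isStraightening_of_chart hy hdim r (fun x i => by rw [hef]) hye heU
    (by rw [het, hef]) hea hes⟩

theorem mem_singularLocus_iff {N p d : ℕ} {U : Opens (Fin N → ℂ)} {φ : Fin p → Hol U}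
    (hdim : HasPureDim (zeroFibre φ) d) (hred : GeneratesIdealOf φ (zeroFibre φ))
    (y : Fin N → ℂ) :
    y ∈ singularLocus (zeroFibre φ) ↔ y ∈ zeroFibre φ ∧
      ∀ (r : Fin (N - d) → Fin p) (c : Fin (N - d) → Fin N),
        ((jacobianAt (fun j => ext (φ j).1) y).submatrix r c).det = 0 := by
  refine and_congr_right fun hy => ⟨fun h r c => ?_, fun h k hk => ?_⟩
  · by_contra hne
    exact h d (isRegularPoint_of_det_ne_zero hy hdim hne)
  · obtain ⟨-, l, e, he⟩ := hk
    have h1 := he.add_eq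
    have h2 := he.eq_of_hasPureDim hy hred hdim
    obtain ⟨r, c, hne⟩ := (exists_det_submatrix_ne_zero_iff
      (jacobianAt (fun j => ext (φ j).1) y) (N - d)).2 (by rw [he.rank_jacobianAt hy hred]; omega)
    exact hne (h r c)

/-! ### Critical points in a straightening -/

theorem sum_smul_map_single {n : ℕ} {V : Type*} [AddCommGroup V] [Module ℂ V]
    (T : (Fin n → ℂ) →ₗ[ℂ] V) (u : Fin n → ℂ) : ∑ i, u i • T (Pi.single i 1) = T u := by
  conv_rhs => rw [pi_eq_sum_univ' u]
  simp

theorem forall_map_single_eq_zero_iff {n : ℕ} {V : Type*} [AddCommGroup V] [Module ℂ V]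
    (T : (Fin n → ℂ) →ₗ[ℂ] V) : (∀ i, T (Pi.single i 1) = 0) ↔ ∀ u, T u = 0 :=
  ⟨fun h u => by simp [← sum_smul_map_single T u, h], fun h _ => h _⟩

theorem fderiv_partialDeriv {n : ℕ} {f : (Fin n → ℂ) → ℂ} {z : Fin n → ℂ}
    (hf : AnalyticAt ℂ f z) (j : Fin n) (v : Fin n → ℂ) :
    fderiv ℂ (partialDeriv j f) z v = fderiv ℂ (fderiv ℂ f) z v (Pi.single j 1) := by
  change fderiv ℂ (fun z => fderiv ℂ f z (Pi.single j 1)) z v = _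
  rw [fderiv_clm_apply hf.fderiv.differentiableAt (differentiableAt_const _)]
  simp

theorem hessian_congr {n : ℕ} {f f' : (Fin n → ℂ) → ℂ} {u : Fin n → ℂ} (h : f =ᶠ[𝓝 u] f') :
    hessian f u = hessian f' u := by
  ext i j
  have h1 : partialDeriv j f =ᶠ[𝓝 u] partialDeriv j f' := by
    filter_upwards [h.fderiv (𝕜 := ℂ)] with x hx
    rw [partialDeriv, hx, partialDeriv]
  change fderiv ℂ (partialDeriv j f) u _ = fderiv ℂ (partialDeriv j f') u _
  rw [h1.fderiv_eq]

/-- Since `df` vanishes at `s u`, the term with the second derivative of `s` drops out. -/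
theorem hessian_comp_apply {n N : ℕ} {s : (Fin n → ℂ) → (Fin N → ℂ)} {f : (Fin N → ℂ) → ℂ}
    {u : Fin n → ℂ} (hs : AnalyticAt ℂ s u) (hf : AnalyticAt ℂ f (s u))
    (h0 : fderiv ℂ f (s u) = 0) (i j : Fin n) :
    hessian (fun u => f (s u)) u i j = fderiv ℂ (fderiv ℂ f) (s u)
      (fderiv ℂ s u (Pi.single i 1)) (fderiv ℂ s u (Pi.single j 1)) := by
  have h1 : partialDeriv j (fun u => f (s u)) =ᶠ[𝓝 u]
      fun x => fderiv ℂ f (s x) (fderiv ℂ s x (Pi.single j 1)) := by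
    filter_upwards [hs.eventually_analyticAt,
      hs.continuousAt.eventually hf.eventually_analyticAt] with x hx hx'
    exact DFunLike.congr_fun (fderiv_comp x hx'.differentiableAt hx.differentiableAt) _
  have h2 : HasFDerivAt (fun x => fderiv ℂ f (s x))
      ((fderiv ℂ (fderiv ℂ f) (s u)).comp (fderiv ℂ s u)) u :=
    HasFDerivAt.comp (g := fderiv ℂ f) (f := s) u hf.fderiv.differentiableAt.hasFDerivAt
      hs.differentiableAt.hasFDerivAt
  have h3 : HasFDerivAt (fun x => fderiv ℂ s x (Pi.single j 1)) _ u :=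
    hs.fderiv.differentiableAt.hasFDerivAt.clm_apply (hasFDerivAt_const _ _)
  change fderiv ℂ (partialDeriv j fun u => f (s u)) u _ = _
  rw [h1.fderiv_eq, (h2.clm_apply h3).fderiv, h0]
  simp

/-- The Jacobian matrix of `G` and `F` as a bordered matrix. -/
theorem jacobianAt_sumElim {N : ℕ} {ι : Type*} (G : (Fin N → ℂ) → ℂ)
    (F : ι → (Fin N → ℂ) → ℂ) (z : Fin N → ℂ) :
    jacobianAt (Sum.elim (fun _ : Fin 1 => G) F) z =
      bordered (fun j => partialDeriv j G z) (jacobianAt F z) := by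
  ext i j
  rcases i with i | i <;> rfl

/-- Lagrange multipliers: a functional that vanishes on the common kernel of finitely many others is
in their span. -/
theorem exists_fderiv_eq_sum {N p : ℕ} {G : (Fin N → ℂ) → ℂ} {F : Fin p → (Fin N → ℂ) → ℂ}
    {y : Fin N → ℂ} (h : ∀ v, (∀ j, fderiv ℂ (F j) y v = 0) → fderiv ℂ G y v = 0) :
    ∃ a : Fin p → ℂ, fderiv ℂ G y = ∑ j, a j • fderiv ℂ (F j) y := by
  have h1 : (fderiv ℂ G y).toLinearMap ∈
      Submodule.span ℂ (Set.range fun j => (fderiv ℂ (F j) y).toLinearMap) := by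
    refine mem_span_of_iInf_ker_le_ker fun v hv => h v fun j => ?_
    exact (Submodule.mem_iInf _).1 hv j
  obtain ⟨a, ha⟩ := (Submodule.mem_span_range_iff_exists_fun ℂ).1 h1
  refine ⟨a, ?_⟩
  ext v
  have := DFunLike.congr_fun ha.symm v
  simpa using this

namespace IsStraightening

variable {N k l p : ℕ} {U : Opens (Fin N → ℂ)} {φ : Fin p → Hol U} {y : Fin N → ℂ}
  {e : OpenPartialHomeomorph (Fin N → ℂ) ((Fin k → ℂ) × (Fin l → ℂ))} {G : (Fin N → ℂ) → ℂ}

theorem forall_partialDeriv_eq_zero_iff (h : IsStraightening (zeroFibre φ) y e)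
    (hy : y ∈ zeroFibre φ) (hred : GeneratesIdealOf φ (zeroFibre φ)) (hG : AnalyticAt ℂ G y) :
    (∀ i, partialDeriv i (fun u => G (e.symm (u, 0))) (e y).1 = 0) ↔
      ∀ v, (∀ j, fderiv ℂ (ext (φ j).1) y v = 0) → fderiv ℂ G y v = 0 := by
  have h1 : HasFDerivAt G (fderiv ℂ G y) (e.symm ((e y).1, 0)) := by
    rw [h.symm_apply_base hy]; exact hG.differentiableAt.hasFDerivAt
  have h2 := HasFDerivAt.comp (f := fun u : Fin k → ℂ => e.symm (u, 0)) (e y).1 h1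
    (h.hasFDerivAt_param hy)
  have h3 : fderiv ℂ (fun u => G (e.symm (u, 0))) (e y).1 = _ := h2.fderiv
  simp only [partialDeriv, h3, h.forall_fderiv_eq_zero_iff hy hred]
  refine (forall_map_single_eq_zero_iff (ContinuousLinearMap.toLinearMap _)).trans ?_
  constructor
  · rintro h v ⟨u, rfl⟩
    exact h u
  · exact fun h u => h _ ⟨u, rfl⟩

theorem forall_minor_eq_zero_iff (h : IsStraightening (zeroFibre φ) y e)
    (hy : y ∈ zeroFibre φ) (hred : GeneratesIdealOf φ (zeroFibre φ)) (w : Fin N → ℂ) :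
    (∀ (r : Fin (l + 1) → Fin 1 ⊕ Fin p) (c : Fin (l + 1) → Fin N),
      ((bordered w (jacobianAt (fun j => ext (φ j).1) y)).submatrix r c).det = 0) ↔
      ∀ v, (∀ j, fderiv ℂ (ext (φ j).1) y v = 0) → w ⬝ᵥ v = 0 := by
  rw [forall_det_bordered_eq_zero_iff w _ (h.rank_jacobianAt hy hred)]
  simp only [jacobianAt_mulVec_eq_zero_iff]

theorem det_jacobianAt_submatrix_eq_zero (h : IsStraightening (zeroFibre φ) y e)
    (hy : y ∈ zeroFibre φ) (hred : GeneratesIdealOf φ (zeroFibre φ))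
    (r : Fin (l + 1) → Fin p) (c : Fin (l + 1) → Fin N) :
    ((jacobianAt (fun j => ext (φ j).1) y).submatrix r c).det = 0 := by
  by_contra hne
  have := (exists_det_submatrix_ne_zero_iff _ (l + 1)).1 ⟨r, c, hne⟩
  rw [h.rank_jacobianAt hy hred] at this
  omega

/-- The derivatives, along the tangent space, of the minors that define the critical locus. -/
theorem fderiv_minor (h : IsStraightening (zeroFibre φ) y e) (hy : y ∈ zeroFibre φ)
    (hred : GeneratesIdealOf φ (zeroFibre φ)) {G₀ : (Fin N → ℂ) → ℂ} (hG : AnalyticAt ℂ G₀ y)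
    (hG0 : fderiv ℂ G₀ y = 0) {a : Fin p → ℂ} (ha : G = fun x => G₀ x + ∑ j, a j * ext (φ j).1 x)
    (u : Fin k → ℂ) (r : Fin (l + 1) → Fin 1 ⊕ Fin p) (c : Fin (l + 1) → Fin N) :
    fderiv ℂ (fun z => ((jacobianAt (Sum.elim (fun _ : Fin 1 => G) fun j => ext (φ j).1)
        z).submatrix r c).det) y (fderiv ℂ e.symm (e y) (u, 0)) =
      ((bordered (fun j => fderiv ℂ (partialDeriv j G₀) y (fderiv ℂ e.symm (e y) (u, 0)))
        (jacobianAt (fun j => ext (φ j).1) y)).submatrix r c).det := by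
  set F : Fin p → (Fin N → ℂ) → ℂ := fun j => ext (φ j).1 with hF
  have hφ : ∀ j, AnalyticAt ℂ (F j) y := fun j => (φ j).2 y hy.1
  have hGa : AnalyticAt ℂ G y := by
    rw [ha]
    exact hG.add (Finset.analyticAt_fun_sum _ fun j _ => analyticAt_const.mul (hφ j))
  have hb : ∀ {w : (Fin N → ℂ) → ℂ}, AnalyticAt ℂ w y →
      AnalyticAt ℂ (fun z => ((bordered (fun j => partialDeriv j w z)
        (jacobianAt F z)).submatrix r c).det) y := by
    intro w hw
    refine analyticAt_det fun i j => ?_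
    rcases hr : r i with i' | i'
    · simpa [bordered, hr] using analyticAt_partialDeriv hw _
    · simpa [bordered, jacobianAt, hr] using analyticAt_partialDeriv (hφ i') _
  -- On `Y` the rows `dG` and `dG₀` differ by a combination of the `dφ k`, which the minors do not
  -- see; hence their tangential derivatives agree.
  have hnear : ∀ᶠ z in 𝓝 y, z ∈ zeroFibre φ →
      ((bordered (fun j => partialDeriv j G z) (jacobianAt F z)).submatrix r c).det -
      ((bordered (fun j => partialDeriv j G₀ z) (jacobianAt F z)).submatrix r c).det = 0 := by
    filter_upwards [e.open_source.mem_nhds h.mem_source, hG.eventually_analyticAt]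
      with z hz hGz hzY
    have hrow : (fun j => partialDeriv j G z) =
        (fun j => partialDeriv j G₀ z) + ∑ k, a k • jacobianAt F z k := by
      funext j
      have h1 : HasFDerivAt G (fderiv ℂ G₀ z + ∑ k, a k • fderiv ℂ (F k) z) z := by
        rw [ha]
        exact hGz.differentiableAt.hasFDerivAt.add (HasFDerivAt.fun_sum fun k _ =>
          ((φ k).2 z hzY.1).differentiableAt.hasFDerivAt.const_mul (a k))
      simp [partialDeriv, h1.fderiv, jacobianAt]
    rw [hrow, det_bordered_add_sum _ _
      ((h.of_mem_source hz).det_jacobianAt_submatrix_eq_zero hzY hred), sub_self]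
  have hd := h.fderiv_eq_zero_of_eventually hy ((hb hGa).sub (hb hG)).differentiableAt hnear u
  simp only [jacobianAt_sumElim]
  rw [fderiv_sub (hb hGa).differentiableAt (hb hG).differentiableAt] at hd
  refine (sub_eq_zero.1 hd).trans ?_
  refine fderiv_det_bordered_of_eq_zero (fun j => analyticAt_partialDeriv hG j)
    (fun i j => analyticAt_partialDeriv (hφ i) j) ?_
    (h.det_jacobianAt_submatrix_eq_zero hy hred) (fun r c => ?_) r c
  · funext j
    simp [partialDeriv, hG0]
  · refine h.fderiv_eq_zero_of_eventually hy
      (analyticAt_det fun i j => analyticAt_partialDeriv (hφ _) _).differentiableAt ?_ u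
    filter_upwards [e.open_source.mem_nhds h.mem_source] with z hz hzY
    exact (h.of_mem_source hz).det_jacobianAt_submatrix_eq_zero hzY hred r c

/-- Degeneracy of the Hessian in terms of the derivatives of the minors that define the critical
locus. -/
theorem det_hessian_eq_zero_iff (h : IsStraightening (zeroFibre φ) y e) (hy : y ∈ zeroFibre φ)
    (hred : GeneratesIdealOf φ (zeroFibre φ)) (hG : AnalyticAt ℂ G y)
    (hcrit : ∀ v, (∀ j, fderiv ℂ (ext (φ j).1) y v = 0) → fderiv ℂ G y v = 0) :
    (hessian (fun u => G (e.symm (u, 0))) (e y).1).det = 0 ↔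
      ∃ v, v ≠ 0 ∧ (∀ j, fderiv ℂ (ext (φ j).1) y v = 0) ∧
        ∀ (r : Fin (l + 1) → Fin 1 ⊕ Fin p) (c : Fin (l + 1) → Fin N),
          fderiv ℂ (fun z => ((jacobianAt (Sum.elim (fun _ : Fin 1 => G) fun j => ext (φ j).1)
            z).submatrix r c).det) y v = 0 := by
  have hφ : ∀ j, AnalyticAt ℂ (ext (φ j).1) y := fun j => (φ j).2 y hy.1
  obtain ⟨a, ha⟩ := exists_fderiv_eq_sum hcrit
  let G₀ : (Fin N → ℂ) → ℂ := fun x => G x - ∑ j, a j * ext (φ j).1 x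
  have hG₀ : AnalyticAt ℂ G₀ y :=
    hG.sub (Finset.analyticAt_fun_sum _ fun j _ => analyticAt_const.mul (hφ j))
  have hG₀0 : fderiv ℂ G₀ y = 0 := by
    have h1 : HasFDerivAt G₀ (fderiv ℂ G y - ∑ k, a k • fderiv ℂ (ext (φ k).1) y) y :=
      hG.differentiableAt.hasFDerivAt.sub (HasFDerivAt.fun_sum fun k _ =>
        (hφ k).differentiableAt.hasFDerivAt.const_mul (a k))
    rw [h1.fderiv, ha, sub_self]
  let T := (fderiv ℂ e.symm (e y)).comp (ContinuousLinearMap.inl ℂ (Fin k → ℂ) (Fin l → ℂ))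
  let Q := fderiv ℂ (fderiv ℂ G₀) y
  have hTinj : ∀ u, T u = 0 ↔ u = 0 := fun u => by
    refine ⟨fun hu => ?_, fun hu => by rw [hu, map_zero]⟩
    exact congrArg Prod.fst ((map_eq_zero_iff _ h.fderivEquiv.symm.injective).1 hu)
  have hH : ∀ i j, hessian (fun u => G (e.symm (u, 0))) (e y).1 i j =
      Q (T (Pi.single i 1)) (T (Pi.single j 1)) := by
    intro i j
    have h1 : (fun u => G (e.symm (u, 0))) =ᶠ[𝓝 (e y).1] fun u => G₀ (e.symm (u, 0)) := by
      filter_upwards [h.eventually_mem_target hy] with u hu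
      obtain ⟨hu1, hu2⟩ := h.symm_mem hu
      have h2 : ∀ j, ext (φ j).1 (e.symm (u, 0)) = 0 := fun j =>
        (ext_apply _ ⟨_, hu1⟩).trans (hu2 j)
      simp [G₀, h2]
    have h2 := h.symm_apply_base hy
    have h3 := hessian_comp_apply (s := fun u : Fin k → ℂ => e.symm (u, 0)) (f := G₀)
      (h.analyticAt_param (by rw [← h.apply_eq hy]; exact e.map_source h.mem_source))
      (by rwa [h2]) (by rwa [h2]) i j
    rw [hessian_congr h1, h3, (h.hasFDerivAt_param hy).fderiv, h2]
  have hQ : ∀ v w, (fun j => fderiv ℂ (partialDeriv j G₀) y v) ⬝ᵥ w = Q v w := by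
    intro v w
    simp only [fderiv_partialDeriv hG₀]
    refine Eq.trans ?_ (sum_smul_map_single (Q v).toLinearMap w)
    simp [dotProduct, mul_comm, Q]
  -- In the chart, the Hessian is the matrix of `Q` restricted to the tangent space, the range of
  -- `T`.
  have hvec : ∀ u, u ᵥ* hessian (fun u => G (e.symm (u, 0))) (e y).1 = 0 ↔
      ∀ w, Q (T u) (T w) = 0 := by
    intro u
    have h1 : ∀ j, (u ᵥ* hessian (fun u => G (e.symm (u, 0))) (e y).1) j =
        Q (T u) (T (Pi.single j 1)) := by
      intro j
      have := sum_smul_map_single ((Q.comp T).toLinearMap) u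
      have := DFunLike.congr_fun this (T (Pi.single j 1))
      simpa [vecMul, dotProduct, hH] using this
    rw [funext_iff]
    simp only [h1]
    exact forall_map_single_eq_zero_iff ((Q (T u)).comp T).toLinearMap
  rw [← exists_vecMul_eq_zero_iff]
  have hkey : ∀ u, (∀ w, Q (T u) (T w) = 0) ↔
      ∀ (r : Fin (l + 1) → Fin 1 ⊕ Fin p) (c : Fin (l + 1) → Fin N),
          fderiv ℂ (fun z => ((jacobianAt (Sum.elim (fun _ : Fin 1 => G) fun j => ext (φ j).1)
            z).submatrix r c).det) y (T u) = 0 := by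
    intro u
    have h1 := h.fderiv_minor hy hred (G := G) hG₀ hG₀0 (a := a) (by simp [G₀]) u
    have h2 := h.forall_minor_eq_zero_iff hy hred
      (fun j => fderiv ℂ (partialDeriv j G₀) y (T u))
    refine Iff.trans ?_ (h2.symm.trans (forall_congr' fun r => forall_congr' fun c => ?_))
    · simp only [hQ, h.forall_fderiv_eq_zero_iff hy hred]
      constructor
      · rintro h v ⟨w, rfl⟩
        exact h w
      · exact fun h w => h _ ⟨w, rfl⟩
    · exact (h1 r c).symm ▸ Iff.rfl
  constructor
  · rintro ⟨u, hu, hu'⟩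
    exact ⟨T u, fun hT => hu ((hTinj u).1 hT),
      (h.forall_fderiv_eq_zero_iff hy hred _).2 ⟨u, rfl⟩, (hkey u).1 ((hvec u).1 hu')⟩
  · rintro ⟨v, hv, hv', hv''⟩
    obtain ⟨u, rfl⟩ := (h.forall_fderiv_eq_zero_iff hy hred _).1 hv'
    exact ⟨u, fun hu => hv ((hTinj u).2 hu), (hvec u).2 ((hkey u).2 hv'')⟩

end IsStraightening

/-! ### Zero loci of Jacobian extensions -/

variable {N : ℕ} {U : Opens (Fin N → ℂ)}

/-- Evaluation at a point of `U`. -/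
def Hol.evalHom (x : U) : Hol U →+* ℂ :=
  (Pi.evalRingHom (fun _ : U => ℂ) x).comp (Hol U).val.toRingHom

theorem mem_zeroLocus_span_iff {ι : Type*} (w : ι → Hol U) (x : Fin N → ℂ) :
    x ∈ zeroLocus (Ideal.span (Set.range w)) ↔ ∃ hx : x ∈ U, ∀ i, (w i).1 ⟨x, hx⟩ = 0 := by
  refine exists_congr fun hx => ⟨fun h i => h _ (Ideal.subset_span ⟨i, rfl⟩), fun h f hf => ?_⟩
  have h1 : Ideal.span (Set.range w) ≤ RingHom.ker (Hol.evalHom ⟨x, hx⟩) := by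
    rw [Ideal.span_le]
    rintro _ ⟨i, rfl⟩
    exact h i
  exact h1 hf

theorem Hol.det_apply {m : ℕ} (M : Matrix (Fin m) (Fin m) (Hol U)) (x : U) :
    M.det.1 x = (Matrix.of fun i j => (M i j).1 x).det :=
  RingHom.map_det (Hol.evalHom x) M

/-- The generators `w`, together with the minors of order `m`, of a Jacobian extension. -/
def jacobianGenerators {κ ι : Type*} (m : ℕ) (h : κ → Hol U) (w : ι → Hol U) :
    ι ⊕ (Fin m → κ ⊕ ι) × (Fin m → Fin N) → Hol U :=
  Sum.elim w fun a => ((jacobianMatrix (Sum.elim h w)).submatrix a.1 a.2).det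

/-- A presentation by generators, finite when `κ` and `ι` are, lets the extension be iterated
without taking all elements of the ideal. -/
theorem jacobianExtension_eq_span {κ ι : Type*} (m : ℕ) (h : κ → Hol U) (w : ι → Hol U) :
    jacobianExtension m h (Ideal.span (Set.range w)) =
      Ideal.span (Set.range (jacobianGenerators m h w)) := by
  rw [jacobianExtension_span, minorsIdeal, ← Ideal.span_union, jacobianGenerators,
    Set.Sum.elim_range]
  congr 2
  ext f
  constructor
  · rintro ⟨r, c, rfl⟩
    exact ⟨(r, c), rfl⟩
  · rintro ⟨a, rfl⟩
    exact ⟨a.1, a.2, rfl⟩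

theorem det_jacobianMatrix_apply {ι : Type*} {m : ℕ} (f : ι → Hol U) (r : Fin m → ι)
    (c : Fin m → Fin N) (x : U) :
    ((jacobianMatrix f).submatrix r c).det.1 x =
      ((jacobianAt (fun i => ext (f i).1) x).submatrix r c).det :=
  Hol.det_apply _ _

theorem ext_det_jacobianMatrix {ι : Type*} {m : ℕ} (f : ι → Hol U) (r : Fin m → ι)
    (c : Fin m → Fin N) {x : Fin N → ℂ} (hx : x ∈ U) :
    ext ((jacobianMatrix f).submatrix r c).det.1 =ᶠ[𝓝 x]
      fun z => ((jacobianAt (fun i => ext (f i).1) z).submatrix r c).det := by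
  filter_upwards [U.isOpen.mem_nhds hx] with z hz
  exact (ext_apply _ ⟨z, hz⟩).trans (det_jacobianMatrix_apply f r c ⟨z, hz⟩)

theorem mem_zeroLocus_jacobianExtension_iff {κ ι : Type*} (m : ℕ) (h : κ → Hol U)
    (w : ι → Hol U) (x : Fin N → ℂ) :
    x ∈ zeroLocus (jacobianExtension m h (Ideal.span (Set.range w))) ↔
      ∃ hx : x ∈ U, (∀ i, (w i).1 ⟨x, hx⟩ = 0) ∧
        ∀ (r : Fin m → κ ⊕ ι) (c : Fin m → Fin N),
          ((jacobianAt (fun i => ext (Sum.elim h w i).1) x).submatrix r c).det = 0 := by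
  rw [jacobianExtension_eq_span, mem_zeroLocus_span_iff]
  refine exists_congr fun hx => ⟨fun h' => ⟨fun i => h' (Sum.inl i), fun r c => ?_⟩, ?_⟩
  · rw [← h' (Sum.inr (r, c))]
    exact (det_jacobianMatrix_apply _ r c ⟨x, hx⟩).symm
  · rintro ⟨h1, h2⟩ (i | a)
    · exact h1 i
    · exact (det_jacobianMatrix_apply _ _ _ ⟨x, hx⟩).trans (h2 a.1 a.2)

theorem zeroLocus_span_union_zeroLocus_span {ι κ : Type*} (w : ι → Hol U) (w' : κ → Hol U) :
    zeroLocus (Ideal.span (Set.range w)) ∪ zeroLocus (Ideal.span (Set.range w')) =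
      zeroLocus (Ideal.span (Set.range fun a : ι × κ => w a.1 * w' a.2)) := by
  ext x
  simp only [Set.mem_union, mem_zeroLocus_span_iff]
  constructor
  · rintro (⟨hx, h⟩ | ⟨hx, h⟩)
    · exact ⟨hx, fun a => mul_eq_zero_of_left (h a.1) _⟩
    · exact ⟨hx, fun a => mul_eq_zero_of_right _ (h a.2)⟩
  · rintro ⟨hx, h⟩
    by_contra! hne
    obtain ⟨i, hi⟩ := hne.1 hx
    obtain ⟨j, hj⟩ := hne.2 hx
    exact mul_ne_zero hi hj (h (i, j))

theorem isAnalyticSubset_zeroLocus_span {ι : Type*} [Finite ι] (w : ι → Hol U) :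
    IsAnalyticSubset U (zeroLocus (Ideal.span (Set.range w))) := by
  have hU : zeroLocus (Ideal.span (Set.range w)) ⊆ U := fun x hx => hx.1
  refine ⟨hU, fun x hx => ⟨U, hx, le_rfl, Nat.card ι, w ∘ (Finite.equivFin ι).symm, ?_⟩⟩
  rw [Set.inter_eq_left.2 hU]
  ext x
  rw [mem_zeroLocus_span_iff]
  exact exists_congr fun hx => (Finite.equivFin ι).symm.forall_congr_right.symm

/-- The zero set of the second Jacobian extension at a regular point. -/
theorem IsStraightening.mem_zeroLocus_iff {k l p : ℕ} {φ : Fin p → Hol U} {y : Fin N → ℂ}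
    {e : OpenPartialHomeomorph (Fin N → ℂ) ((Fin k → ℂ) × (Fin l → ℂ))}
    (he : IsStraightening (zeroFibre φ) y e) (hy : y ∈ zeroFibre φ)
    (hred : GeneratesIdealOf φ (zeroFibre φ)) (g : Hol U) :
    y ∈ zeroLocus (jacobianExtension N (fun _ : Fin 1 => g)
        (jacobianExtension (l + 1) (fun _ : Fin 1 => g) (Ideal.span (Set.range φ)))) ↔
      (∀ i, partialDeriv i (fun u => ext g.1 (e.symm (u, 0))) (e y).1 = 0) ∧
        (hessian (fun u => ext g.1 (e.symm (u, 0))) (e y).1).det = 0 := by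
  have hg : AnalyticAt ℂ (ext g.1) y := g.2 y hy.1
  have helim : (fun i => ext (Sum.elim (fun _ : Fin 1 => g) φ i).1) =
      Sum.elim (fun _ => ext g.1) fun j => ext (φ j).1 := by
    funext i
    rcases i with i | i <;> rfl
  rw [he.forall_partialDeriv_eq_zero_iff hy hred hg, jacobianExtension_eq_span,
    mem_zeroLocus_jacobianExtension_iff]
  have hcrit : (∀ i, (jacobianGenerators (l + 1) (fun _ : Fin 1 => g) φ i).1 ⟨y, hy.1⟩ = 0) ↔
      ∀ v, (∀ j, fderiv ℂ (ext (φ j).1) y v = 0) → fderiv ℂ (ext g.1) y v = 0 := by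
    simp only [fderiv_eq_dotProduct (ext g.1)]
    rw [← he.forall_minor_eq_zero_iff hy hred, ← jacobianAt_sumElim, ← helim, Sum.forall,
      Prod.forall]
    refine (and_iff_right fun j => hy.2 j).trans (forall_congr' fun r => forall_congr' fun c => ?_)
    rw [← det_jacobianMatrix_apply _ r c ⟨y, hy.1⟩]
    rfl
  rw [exists_prop_of_true hy.1, hcrit]
  refine and_congr_right fun hc => ?_
  -- Minors of order `N` in a matrix with `N` columns all vanish exactly when the kernel is nonzero.
  rw [he.det_hessian_eq_zero_iff hy hred hg hc, forall_det_submatrix_eq_zero_iff]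
  refine exists_congr fun v => and_congr_right fun _ => ?_
  rw [jacobianAt_mulVec_eq_zero_iff, Sum.forall, Sum.forall, Prod.forall]
  have hminor : ∀ r c, fderiv ℂ (ext (Sum.elim (fun _ : Fin 1 => g)
      (jacobianGenerators (l + 1) (fun _ : Fin 1 => g) φ) (Sum.inr (Sum.inr (r, c)))).1) y =
      fderiv ℂ (fun z => ((jacobianAt (Sum.elim (fun _ : Fin 1 => ext g.1) fun j => ext (φ j).1)
            z).submatrix r c).det) y := by
    intro r c
    rw [← helim]
    exact (ext_det_jacobianMatrix _ r c hy.1).fderiv_eq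
  simp only [hminor]
  -- The row `dg` adds no condition: `v` is tangent and `y` is critical.
  exact ⟨fun h => h.2, fun h => ⟨fun _ => hc v h.1, h⟩⟩

theorem singularLocus_eq_zeroLocus {p d : ℕ} {φ : Fin p → Hol U}
    (hdim : HasPureDim (zeroFibre φ) d) (hred : GeneratesIdealOf φ (zeroFibre φ)) :
    singularLocus (zeroFibre φ) = zeroLocus (Ideal.span (Set.range
      (Sum.elim φ fun a : (Fin (N - d) → Fin p) × (Fin (N - d) → Fin N) =>
        ((jacobianMatrix φ).submatrix a.1 a.2).det))) := by
  ext y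
  rw [mem_singularLocus_iff hdim hred, mem_zeroLocus_span_iff]
  constructor
  · rintro ⟨hy, h⟩
    refine ⟨hy.1, ?_⟩
    rintro (j | a)
    · exact hy.2 j
    · exact (det_jacobianMatrix_apply _ _ _ ⟨y, hy.1⟩).trans (h a.1 a.2)
  · rintro ⟨hy, h⟩
    exact ⟨⟨hy, fun j => h (Sum.inl j)⟩, fun r c =>
      (det_jacobianMatrix_apply _ _ _ ⟨y, hy⟩).symm.trans (h (Sum.inr (r, c)))⟩

end JacobianExtension

end

theorem mainTheorem12 {N p d : ℕ} (U : TopologicalSpace.Opens (Fin N → ℂ))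
    (φ : Fin p → Hol U) (Y : Set (Fin N → ℂ)) (hY : Y = zeroFibre φ)
    (hdim : HasPureDim Y d) (hred : GeneratesIdealOf φ Y) (g : Hol U) :
    {y | y ∈ singularLocus Y ∨ IsDegenerateCriticalPoint Y (ext g.1) y} =
        zeroLocus (iteratedJacobianExtension [d, 1] (fun _ : Fin 1 => g)
          (Ideal.span (Set.range φ))) ∪ singularLocus Y ∧
      IsAnalyticSubset U
        (zeroLocus (iteratedJacobianExtension [d, 1] (fun _ : Fin 1 => g)
          (Ideal.span (Set.range φ))) ∪ singularLocus Y) := by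
  subst hY
  -- The second order is `N + 1 - 1`, which reduces to `N`.
  have hJ : iteratedJacobianExtension [d, 1] (fun _ : Fin 1 => g) (Ideal.span (Set.range φ)) =
      jacobianExtension N (fun _ : Fin 1 => g)
        (jacobianExtension (N + 1 - d) (fun _ : Fin 1 => g) (Ideal.span (Set.range φ))) := rfl
  rw [hJ]
  constructor
  · have key : ∀ {k l : ℕ} {y : Fin N → ℂ}
        {e : OpenPartialHomeomorph (Fin N → ℂ) ((Fin k → ℂ) × (Fin l → ℂ))},
        IsStraightening (zeroFibre φ) y e → y ∈ zeroFibre φ → N + 1 - d = l + 1 := by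
      intro k l y e he hy
      have h1 := he.add_eq
      have h2 := he.eq_of_hasPureDim hy hred hdim
      omega
    ext y
    constructor
    · rintro (hs | ⟨hy, k, l, e, he, hcrit, hhess⟩)
      · exact Or.inr hs
      · rw [key he hy]
        exact Or.inl ((he.mem_zeroLocus_iff hy hred g).2 ⟨hcrit, hhess⟩)
    · rintro (hv | hs)
      · have hy : y ∈ zeroFibre φ :=
          ⟨hv.1, fun j => hv.2 _ (Ideal.mem_sup_left (Ideal.mem_sup_left
            (Ideal.subset_span ⟨j, rfl⟩)))⟩
        by_cases hs : y ∈ singularLocus (zeroFibre φ)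
        · exact Or.inl hs
        · obtain ⟨k, -, l, e, he⟩ : ∃ k, IsRegularPoint (zeroFibre φ) k y := by
            by_contra! hne
            exact hs ⟨hy, hne⟩
          rw [key he hy] at hv
          exact Or.inr ⟨hy, k, l, e, he, (he.mem_zeroLocus_iff hy hred g).1 hv⟩
      · exact Or.inl hs
  -- Both sets are zero sets of finitely many functions on all of `U`; pairwise products define the
  -- union.
  · rw [singularLocus_eq_zeroLocus hdim hred, jacobianExtension_eq_span,
      jacobianExtension_eq_span, zeroLocus_span_union_zeroLocus_span]
    exact isAnalyticSubset_zeroLocus_span _
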